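/- Let $\Gamma$ be a finite group with set of conjugacy classes $\Gamma_*$, let $c^0\in\Gamma_*$ be the class of the identity, and let $\Gamma_n=\Gamma^n\rtimes S_n$ ($n\ge 0$) be the wreath product, with $(g,\sigma)(h,\tau)=(g\,\sigma(h),\sigma\tau)$ and $\sigma(h)_i=h_{\sigma^{-1}(i)}$. Let $\mathcal P(\Gamma_*)$ be the set of partition-valued functions on $\Gamma_*$; for $\rho\in\mathcal P(\Gamma_*)$ put $\|\rho\|=\sum_{c}|\rho(c)|$. The type of $x=(g,\sigma)\in\Gamma_n$ is the function $\rho\in\mathcal P(\Gamma_*)$ for which the parts of $\rho(c)$ are the lengths of the cycles $(i_1\,i_2\cdots i_k)$ of $\sigma$ (fixed points included) whose cycle-product $g_{i_k}\cdots g_{i_1}$ lies in $c$. The modified type of $x$ is obtained from $\rho$ by diminishing every part of $\rho(c^0)$ by $1$ and dropping the resulting zeros. Let $R_{\mathbb Z}(\Gamma_n)$ be the center of $\mathbb Z[\Gamma_n]$, and for $\mu\in\mathcal P(\Gamma_*)$ let $K_\mu(n)\in R_{\mathbb Z}(\Gamma_n)$ be the sum of all elements of $\Gamma_n$ of modified type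 $\mu$. Let $R\subset\mathbb Q[t]$ be the ring of polynomials that take integer values at all integers. (1) For every $n$ the subgroups of $R_{\mathbb Z}(\Gamma_n)$ spanned by $\{K_\mu(n):\|\mu\|\le d\}$, $d\ge0$, form a ring filtration. Let $\mathcal G_\Gamma(n)$ be the associated graded ring, and write $K_\mu(n)$ also for the class of $K_\mu(n)$ in its component of degree $\|\mu\|$. Then $K_\mu(n)=0$ if $\|\mu\|+\ell(\mu(c^0))>n$, the classes $K_\mu(n)$ with $\|\mu\|+\ell(\mu(c^0))\le n$ form a $\mathbb Z$-basis of $\mathcal G_\Gamma(n)$, and there are non-negative integers $a_{\lambda\mu}^\nu$, independent of $n$, such that for all $n$ and all $\lambda,\mu\in\mathcal P(\Gamma_*)$, in $\mathcal G_\Gamma(n)$, $$K_\lambda(n)K_\mu(n)=\sum_{\|\nu\|=\|\lambda\|+\|\mu\|}a_{\lambda\mu}^\nu K_\nu(n).$$ (2) There is a unique family of elements $f_{\lambda\mu}^\nu\in R$ (for fixed $\lambda,\mu$ almost all of them zero) such that $K_\lambda(n)K_\mu(n)=\sum_\nu f_{\lambda\mu}^\nu(n)K_\nu(n)$ in $R_{\mathbb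 Z}(\Gamma_n)$ for all $n,\lambda,\mu$. One has $f_{\lambda\mu}^\nu=0$ if $\|\nu\|>\|\lambda\|+\|\mu\|$, and $f_{\lambda\mu}^\nu=a_{\lambda\mu}^\nu$ is constant if $\|\nu\|=\|\lambda\|+\|\mu\|$. (3) There is a commutative ring $\mathcal G_\Gamma$ (the Farahat–Higman ring) with $\mathbb Z$-basis $(K_\lambda)_{\lambda\in\mathcal P(\Gamma_*)}$ and multiplication $K_\lambda K_\mu=\sum_{\|\nu\|=\|\lambda\|+\|\mu\|}a_{\lambda\mu}^\nu K_\nu$, and there is a commutative $R$-algebra $\mathcal F_\Gamma$ with $R$-basis $(K_\lambda)_{\lambda\in\mathcal P(\Gamma_*)}$ and multiplication $K_\lambda K_\mu=\sum_\nu f_{\lambda\mu}^\nu K_\nu$. (4) The $R$-submodules of $\mathcal F_\Gamma$ spanned by $\{K_\lambda:\|\lambda\|\le d\}$, $d\ge0$, form a ring filtration, and its associated graded ring is isomorphic, as a graded $R$-algebra, to $R\otimes_{\mathbb Z}\mathcal G_\Gamma$ (where $1\otimes K_\lambda$ has degree $\|\lambda\|$); the isomorphism sends the class of $K_\lambda$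 in degree $\|\lambda\|$ to $1\otimes K_\lambda$. -/

import Mathlib

open scoped DirectSum TensorProduct Polynomial

universe u v w

noncomputable section

namespace FarahatHigman

/-! ### The graded ring associated to a filtered commutative algebra -/

section AssociatedGraded

variable {S A : Type*} [CommRing S] [CommRing A] [Algebra S A]

/-- The part of degree `< d` of an increasing filtration `F 0 ≤ F 1 ≤ ...`. -/
def filLT (F : ℕ → Submodule S A) (d : ℕ) : Submodule S A := ⨆ i, ⨆ _ : i < d, F i

/-- The quotient `F d / F (d - 1)`, where `F (-1) = 0`. -/
def GrPiece (F : ℕ → Submodule S A) (d : ℕ) : Type _ :=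
  (F d) ⧸ ((filLT F d).submoduleOf (F d))

instance (F : ℕ → Submodule S A) (d : ℕ) : AddCommGroup (GrPiece F d) :=
  inferInstanceAs (AddCommGroup ((F d) ⧸ ((filLT F d).submoduleOf (F d))))

instance (F : ℕ → Submodule S A) (d : ℕ) : Module S (GrPiece F d) :=
  inferInstanceAs (Module S ((F d) ⧸ ((filLT F d).submoduleOf (F d))))

/-- The projection `F d → F d / F (d - 1)`. -/
def grMk (F : ℕ → Submodule S A) (d : ℕ) : (F d) →ₗ[S] GrPiece F d :=
  ((filLT F d).submoduleOf (F d)).mkQ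

theorem grMk_surjective (F : ℕ → Submodule S A) (d : ℕ) : Function.Surjective (grMk F d) :=
  Submodule.mkQ_surjective _

theorem grMk_eq_zero (F : ℕ → Submodule S A) (d : ℕ) (a : F d) :
    grMk F d a = 0 ↔ (a : A) ∈ filLT F d :=
  (Submodule.Quotient.mk_eq_zero ((filLT F d).submoduleOf (F d))).trans Submodule.mem_comap

/-- The graded ring `⨁ d, F d / F (d - 1)` associated to the filtration `F`. -/
abbrev AssocGr (F : ℕ → Submodule S A) : Type _ := ⨁ d, GrPiece F d

variable (F : ℕ → Submodule S A)

theorem gradedMonoid_ext {i j : ℕ} (h : i = j) (a : F i) (b : F j) (hab : (a : A) = b) :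
    (GradedMonoid.mk i (grMk F i a) : GradedMonoid (GrPiece F)) =
      GradedMonoid.mk j (grMk F j b) := by
  subst h
  rw [Subtype.ext hab]

section Ring

variable [hF : IsRingFiltration F (filLT F)]

theorem filLT_mul_mem {i j : ℕ} {a b : A} (ha : a ∈ filLT F i) (hb : b ∈ F j) :
    a * b ∈ filLT F (i + j) := by
  have h : filLT F i ≤ (filLT F (i + j)).comap (LinearMap.mulRight S b) := by
    refine iSup₂_le fun k hk x hx => ?_
    have h1 : x * b ∈ F (k + j) := SetLike.mul_mem_graded hx hb
    exact hF.is_le (by omega : k + j < i + j) h1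
  exact h ha

/-- Multiplication `F i × F j → F (i + j)`, followed by the projection. -/
def mulAux (i j : ℕ) : F i →ₗ[S] F j →ₗ[S] GrPiece F (i + j) :=
  LinearMap.mk₂ S (fun a b => grMk F (i + j) ⟨a * b, SetLike.mul_mem_graded a.2 b.2⟩)
    (fun a a' b => by
      rw [← map_add]; congr 1; ext; simp [add_mul])
    (fun c a b => by
      rw [← map_smul]; congr 1; ext; simp)
    (fun a b b' => by
      rw [← map_add]; congr 1; ext; simp [mul_add])
    (fun c a b => by
      rw [← map_smul]; congr 1; ext; simp)

/-- The product `[a] * [b] = [a * b]` on the graded pieces. -/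
def grMul (i j : ℕ) : GrPiece F i →ₗ[S] GrPiece F j →ₗ[S] GrPiece F (i + j) :=
  Submodule.liftQ _
    (LinearMap.flip (Submodule.liftQ _ (LinearMap.flip (mulAux F i j)) (by
      intro b hb
      rw [LinearMap.mem_ker]
      ext a
      refine (grMk_eq_zero F _ _).2 ?_
      have hb' : (b : A) ∈ filLT F j := hb
      have := filLT_mul_mem F hb' a.2
      rw [add_comm j i, mul_comm] at this
      exact this)))
    (by
      intro a ha
      rw [LinearMap.mem_ker]
      ext b
      obtain ⟨b, rfl⟩ := grMk_surjective F j b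
      refine (grMk_eq_zero F _ _).2 ?_
      have ha' : (a : A) ∈ filLT F i := ha
      exact filLT_mul_mem F ha' b.2)

theorem grMul_mk {i j : ℕ} (a : F i) (b : F j) :
    grMul F i j (grMk F i a) (grMk F j b) =
      grMk F (i + j) ⟨a * b, SetLike.mul_mem_graded a.2 b.2⟩ := rfl

/-- The unit of the graded ring: the class of `1 ∈ F 0`. -/
def grOne : GrPiece F 0 := grMk F 0 ⟨1, SetLike.one_mem_graded F⟩

instance : GradedMonoid.GMul (GrPiece F) where
  mul {i j} a b := grMul F i j a b

instance : GradedMonoid.GOne (GrPiece F) where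
  one := grOne F

instance : GradedMonoid.GMonoid (GrPiece F) where
  one_mul := by
    rintro ⟨i, a⟩
    obtain ⟨a, rfl⟩ := grMk_surjective F i a
    exact gradedMonoid_ext F (zero_add i) _ _ (one_mul (a : A))
  mul_one := by
    rintro ⟨i, a⟩
    obtain ⟨a, rfl⟩ := grMk_surjective F i a
    exact gradedMonoid_ext F (add_zero i) _ _ (mul_one (a : A))
  mul_assoc := by
    rintro ⟨i, a⟩ ⟨j, b⟩ ⟨k, c⟩
    obtain ⟨a, rfl⟩ := grMk_surjective F i a
    obtain ⟨b, rfl⟩ := grMk_surjective F j b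
    obtain ⟨c, rfl⟩ := grMk_surjective F k c
    exact gradedMonoid_ext F (add_assoc i j k) _ _ (mul_assoc (a : A) b c)

instance : DirectSum.GCommRing (GrPiece F) where
  mul_comm := by
    rintro ⟨i, a⟩ ⟨j, b⟩
    obtain ⟨a, rfl⟩ := grMk_surjective F i a
    obtain ⟨b, rfl⟩ := grMk_surjective F j b
    exact gradedMonoid_ext F (add_comm i j) _ _ (mul_comm (a : A) b)
  mul_zero a := map_zero _
  zero_mul b := LinearMap.map_zero₂ _ b
  mul_add a b c := map_add _ b c
  add_mul a b c := LinearMap.map_add₂ _ a b c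
  natCast n := n • grOne F
  natCast_zero := zero_smul _ _
  natCast_succ n := succ_nsmul _ n
  intCast n := n • grOne F
  intCast_ofNat n := natCast_zsmul _ n
  intCast_negSucc_ofNat n := negSucc_zsmul _ n

instance : DirectSum.GAlgebra S (GrPiece F) where
  toFun := ((LinearMap.toSpanSingleton S (GrPiece F 0) (grOne F)) : S →+ GrPiece F 0)
  map_one := one_smul S (grOne F)
  map_mul r s := by
    refine gradedMonoid_ext F (zero_add 0).symm
      ((r * s) • ⟨1, SetLike.one_mem_graded F⟩) ⟨(r • 1) * (s • 1), _⟩ ?_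
    simp [mul_smul, smul_comm r s]
  commutes := by
    rintro r ⟨i, a⟩
    obtain ⟨a, rfl⟩ := grMk_surjective F i a
    refine gradedMonoid_ext F (add_comm 0 i) ⟨(r • 1) * a, _⟩ ⟨a * (r • 1), _⟩ ?_
    exact mul_comm _ _
  smul_def := by
    rintro r ⟨i, a⟩
    obtain ⟨a, rfl⟩ := grMk_surjective F i a
    refine gradedMonoid_ext F (zero_add i).symm (r • a) ⟨(r • 1) * a, _⟩ ?_
    simp

end Ring

/-- The class in degree `d` of the associated graded ring of an element `a` of `F d`. -/
def symb (d : ℕ) (a : A) (ha : a ∈ F d) : AssocGr F :=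
  DirectSum.of (GrPiece F) d (grMk F d ⟨a, ha⟩)

end AssociatedGraded

/-! ### Wreath products and types of their elements -/

/-- The wreath product `Γ_n = Γ^n ⋊ S_n`, with `(g, σ) (h, τ) = (g σ(h), σ τ)` and
`σ(h)_i = h_{σ⁻¹(i)}`. -/
abbrev Wreath (Γ : Type*) [Group Γ] (n : ℕ) : Type _ :=
  (Fin n → Γ) ⋊[mulAutArrow (G := Equiv.Perm (Fin n)) (A := Fin n) (M := Γ)] Equiv.Perm (Fin n)

/-- Partition-valued functions on the set of conjugacy classes of `Γ`; a partition is the multiset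
of its (positive) parts. -/
abbrev PartFun (Γ : Type*) [Group Γ] : Type _ := ConjClasses Γ → Multiset ℕ+

section Types

variable {Γ : Type*} [Group Γ]

/-- The degree `‖ρ‖`: the total size of the partitions `ρ(c)`. -/
def PartFun.degree (ρ : PartFun Γ) : ℕ := ∑ᶠ c, ((ρ c).map (fun k : ℕ+ => (k : ℕ))).sum

/-- The number `‖ρ‖ + ℓ(ρ(c⁰))`, where `c⁰` is the class of the identity. -/
def PartFun.supportSize (ρ : PartFun Γ) : ℕ := ρ.degree + (ρ 1).card

variable {n : ℕ}

/-- The product `g_{σ^{k-1}(i)} ⋯ g_{σ(i)} g_i`, for `x = (g, σ)`. -/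
def pathProd (x : Wreath Γ n) (i : Fin n) : ℕ → Γ
  | 0 => 1
  | k + 1 => x.left ((x.right ^ k) i) * pathProd x i k

/-- The length of the cycle of `σ` through `i`, for `x = (g, σ)`. -/
def cycleLen (x : Wreath Γ n) (i : Fin n) : ℕ+ :=
  ⟨Function.minimalPeriod x.right i, Function.minimalPeriod_pos_of_mem_periodicPts
    (Function.Injective.mem_periodicPts x.right.injective i)⟩

/-- The conjugacy class of the cycle-product `g_{i_k} ⋯ g_{i_1}` of the cycle
`(i_1 i_2 ⋯ i_k)` of `σ` that starts at `i_1 = i`, for `x = (g, σ)`. -/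
def cycleClass (x : Wreath Γ n) (i : Fin n) : ConjClasses Γ :=
  ConjClasses.mk (pathProd x i (cycleLen x i))

theorem pow_cycleLen (x : Wreath Γ n) (i : Fin n) : (x.right ^ (cycleLen x i : ℕ)) i = i := by
  rw [Equiv.Perm.coe_pow]
  exact Function.isPeriodicPt_minimalPeriod _ _

theorem cycleLen_apply (x : Wreath Γ n) (i : Fin n) : cycleLen x (x.right i) = cycleLen x i :=
  Subtype.ext (Function.minimalPeriod_apply
    (Function.Injective.mem_periodicPts x.right.injective i))

theorem pathProd_apply (x : Wreath Γ n) (i : Fin n) (k : ℕ) :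
    pathProd x (x.right i) k * x.left i = pathProd x i (k + 1) := by
  induction k with
  | zero => simp [pathProd]
  | succ k ih =>
    rw [pathProd, mul_assoc, ih, pathProd.eq_def x i (k + 1 + 1)]
    simp [pow_succ]

theorem cycleClass_apply (x : Wreath Γ n) (i : Fin n) :
    cycleClass x (x.right i) = cycleClass x i := by
  unfold cycleClass
  rw [cycleLen_apply, ConjClasses.mk_eq_mk_iff_isConj, isConj_comm, isConj_iff]
  refine ⟨x.left i, ?_⟩
  rw [mul_inv_eq_iff_eq_mul, pathProd_apply, pathProd, pow_cycleLen]

theorem sameCycle_induction {α : Type*} (x : Wreath Γ n) (f : Fin n → α)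
    (hf : ∀ i, f (x.right i) = f i) {i j : Fin n} (h : x.right.SameCycle i j) : f i = f j := by
  obtain ⟨k, rfl⟩ := h.exists_nat_pow_eq
  induction k with
  | zero => rfl
  | succ k ih =>
    rw [pow_succ', Equiv.Perm.mul_apply, hf]
    exact ih ⟨k, by simp⟩

/-- The set of cycles of `σ`, including the fixed points, for `x = (g, σ)`. -/
abbrev Cycles (x : Wreath Γ n) : Type := Quotient (Equiv.Perm.SameCycle.setoid x.right)

/-- The length of a cycle. -/
def Cycles.len (x : Wreath Γ n) : Cycles x → ℕ+ :=
  Quotient.lift (cycleLen x) fun _ _ h => sameCycle_induction x _ (cycleLen_apply x) h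

/-- The conjugacy class of the cycle-product of a cycle. -/
def Cycles.prodClass (x : Wreath Γ n) : Cycles x → ConjClasses Γ :=
  Quotient.lift (cycleClass x) fun _ _ h => sameCycle_induction x _ (cycleClass_apply x) h

instance (x : Wreath Γ n) : Fintype (Cycles x) := Fintype.ofFinite _

open scoped Classical in
/-- The type of `x`: the parts of `ρ(c)` are the lengths of the cycles whose cycle-product
lies in `c`. -/
def typeOf (x : Wreath Γ n) : PartFun Γ := fun c =>
  (Finset.univ.filter fun y : Cycles x => Cycles.prodClass x y = c).val.map (Cycles.len x)

open scoped Classical in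
/-- The modified type: in the partition attached to the identity class, every part is diminished
by `1` (and the parts equal to `1` disappear). -/
def modifiedType (x : Wreath Γ n) : PartFun Γ := fun c =>
  if c = 1 then ((typeOf x c).filter (fun k => 1 < k)).map (fun k => k - 1) else typeOf x c

theorem conj_left_apply (z x : Wreath Γ n) (i : Fin n) :
    (z * x * z⁻¹).left (z.right i) =
      z.left (z.right i) * x.left i * (z.left (z.right (x.right⁻¹ i)))⁻¹ := by
  have h : ∀ (σ : Equiv.Perm (Fin n)) (f : Fin n → Γ) (j : Fin n),
      (mulAutArrow (G := Equiv.Perm (Fin n)) σ f) j = f (σ⁻¹ j) := fun _ _ _ => rfl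
  simp [h, mul_assoc]
  rfl

theorem pathProd_conj (z x : Wreath Γ n) (i : Fin n) (k : ℕ) :
    pathProd (z * x * z⁻¹) (z.right i) k =
      z.left (z.right (x.right⁻¹ ((x.right ^ k) i))) * pathProd x i k *
        (z.left (z.right (x.right⁻¹ i)))⁻¹ := by
  induction k with
  | zero => simp [pathProd]
  | succ k ih =>
    have h : ((z * x * z⁻¹).right ^ k) (z.right i) = z.right ((x.right ^ k) i) := by
      have : (z * x * z⁻¹).right = z.right * x.right * z.right⁻¹ := by simp
      rw [this, conj_pow]
      simp
    rw [pathProd, h, conj_left_apply, ih, pathProd]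
    simp [pow_succ', mul_assoc]

theorem cycleLen_conj (z x : Wreath Γ n) (i : Fin n) :
    cycleLen (z * x * z⁻¹) (z.right i) = cycleLen x i := by
  refine Subtype.ext ?_
  change Function.minimalPeriod _ _ = Function.minimalPeriod _ _
  refine (Function.minimalPeriod_eq_minimalPeriod_iff).2 fun k => ?_
  unfold Function.IsPeriodicPt Function.IsFixedPt
  rw [← Equiv.Perm.coe_pow, ← Equiv.Perm.coe_pow]
  have : (z * x * z⁻¹).right = z.right * x.right * z.right⁻¹ := by simp
  rw [this, conj_pow]
  simp

theorem cycleClass_conj (z x : Wreath Γ n) (i : Fin n) :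
    cycleClass (z * x * z⁻¹) (z.right i) = cycleClass x i := by
  unfold cycleClass
  rw [cycleLen_conj, pathProd_conj, pow_cycleLen, ConjClasses.mk_eq_mk_iff_isConj, isConj_comm,
    isConj_iff]
  exact ⟨_, rfl⟩

theorem typeOf_conj (z x : Wreath Γ n) : typeOf (z * x * z⁻¹) = typeOf x := by
  classical
  let e : Cycles x ≃ Cycles (z * x * z⁻¹) := Quotient.congr z.right (by
    intro i j
    have : (z * x * z⁻¹).right = z.right * x.right * z.right⁻¹ := by simp
    change x.right.SameCycle i j ↔ (z * x * z⁻¹).right.SameCycle (z.right i) (z.right j)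
    rw [this, Equiv.Perm.sameCycle_conj]
    simp)
  have hlen : ∀ y, Cycles.len (z * x * z⁻¹) (e y) = Cycles.len x y := by
    rintro ⟨i⟩
    exact cycleLen_conj z x i
  have hclass : ∀ y, Cycles.prodClass (z * x * z⁻¹) (e y) = Cycles.prodClass x y := by
    rintro ⟨i⟩
    exact cycleClass_conj z x i
  funext c
  unfold typeOf
  rw [← Finset.map_univ_equiv e, Finset.filter_map, Finset.map_val, Multiset.map_map]
  simp [Function.comp_def, hlen, hclass]

theorem modifiedType_conj (z x : Wreath Γ n) : modifiedType (z * x * z⁻¹) = modifiedType x := by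
  unfold modifiedType
  rw [typeOf_conj]

end Types

/-! ### Class algebras -/

section ClassAlgebra

variable (Γ : Type*) [Group Γ] [Finite Γ]

instance (n : ℕ) : Finite (Wreath Γ n) := Finite.of_equiv _ SemidirectProduct.equivProd.symm

instance (n : ℕ) : Fintype (Wreath Γ n) := Fintype.ofFinite _

/-- The integral class algebra of `Γ_n`: the center of the group ring `ℤ[Γ_n]`. -/
abbrev ClassAlgebra (n : ℕ) : Type _ := Subalgebra.center ℤ (MonoidAlgebra ℤ (Wreath Γ n))

variable {Γ}

open scoped Classical in
/-- The sum in `ℤ[Γ_n]` of all elements of modified type `μ`. -/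
def classSum (n : ℕ) (μ : PartFun Γ) : MonoidAlgebra ℤ (Wreath Γ n) :=
  ∑ x : Wreath Γ n with modifiedType x = μ, MonoidAlgebra.of ℤ (Wreath Γ n) x

theorem classSum_mem_center (n : ℕ) (μ : PartFun Γ) :
    classSum n μ ∈ Subalgebra.center ℤ (MonoidAlgebra ℤ (Wreath Γ n)) := by
  classical
  have key : ∀ z : Wreath Γ n, MonoidAlgebra.of ℤ _ z * classSum n μ =
      classSum n μ * MonoidAlgebra.of ℤ _ z := by
    intro z
    unfold classSum
    rw [Finset.mul_sum, Finset.sum_mul]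
    refine Finset.sum_equiv (MulAut.conj z).toEquiv (fun x => ?_) fun x _ => ?_
    · simp [modifiedType_conj]
    · rw [← map_mul, ← map_mul]
      simp
  rw [Subalgebra.mem_center_iff]
  intro b
  induction b using MonoidAlgebra.induction_on with
  | of z => exact key z
  | add a b ha hb => rw [add_mul, mul_add, ha, hb]
  | smul r a ha => rw [smul_mul_assoc, mul_smul_comm, ha]

/-- The element `K_μ(n)` of the class algebra. -/
def K (n : ℕ) (μ : PartFun Γ) : ClassAlgebra Γ n := ⟨classSum n μ, classSum_mem_center n μ⟩

end ClassAlgebra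

/-! ### Filtrations by degree -/

section Filtration

variable {Γ : Type*} [Group Γ] {S A : Type*} [CommRing S] [CommRing A] [Algebra S A]

/-- The filtration obtained by assigning degree `‖μ‖` to `b μ`: its `d`-th term is spanned by
the `b μ` with `‖μ‖ ≤ d`. -/
def degFil (S : Type*) [CommRing S] [Algebra S A] (b : PartFun Γ → A) (d : ℕ) : Submodule S A :=
  Submodule.span S (b '' {μ | μ.degree ≤ d})

theorem mem_degFil (b : PartFun Γ → A) (μ : PartFun Γ) : b μ ∈ degFil S b μ.degree :=
  Submodule.subset_span ⟨μ, le_refl μ.degree, rfl⟩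

/-- The class of `b μ` in degree `‖μ‖` of the graded ring associated to the filtration
by degree. -/
def grClass (S : Type*) [CommRing S] [Algebra S A] (b : PartFun Γ → A) (μ : PartFun Γ) :
    AssocGr (degFil S b) :=
  symb (degFil S b) μ.degree (b μ) (mem_degFil b μ)

/-- Multiplication table: `b λ * b μ = ∑ ν, c λ μ ν • b ν`. -/
def HasMulTable {T : Type*} [Zero T] [SMul T A] (b : PartFun Γ → A)
    (c : PartFun Γ → PartFun Γ → PartFun Γ →₀ T) : Prop :=
  ∀ l m, b l * b m = (c l m).sum fun ν r => r • b ν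

end Filtration

/-! ### Integer-valued polynomials -/

/-- The ring `R` of polynomials in `ℚ[t]` that take integer values at all integers. -/
def intValued : Subring ℚ[X] where
  carrier := {p | ∀ n : ℤ, ∃ m : ℤ, p.eval (n : ℚ) = m}
  mul_mem' {p q} hp hq n := by
    obtain ⟨a, ha⟩ := hp n
    obtain ⟨b, hb⟩ := hq n
    exact ⟨a * b, by simp [ha, hb]⟩
  add_mem' {p q} hp hq n := by
    obtain ⟨a, ha⟩ := hp n
    obtain ⟨b, hb⟩ := hq n
    exact ⟨a + b, by simp [ha, hb]⟩
  neg_mem' {p} hp n := by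
    obtain ⟨a, ha⟩ := hp n
    exact ⟨-a, by simp [ha]⟩
  one_mem' n := ⟨1, by simp⟩
  zero_mem' n := ⟨0, by simp⟩

/-- The integer value of `p ∈ R` at the integer `n`. -/
def intEval (p : intValued) (n : ℤ) : ℤ := Classical.choose (p.2 n)

theorem intEval_spec (p : intValued) (n : ℤ) :
    (p : ℚ[X]).eval (n : ℚ) = (intEval p n : ℚ) := Classical.choose_spec (p.2 n)

end FarahatHigman

end

open FarahatHigman

noncomputable section

namespace FarahatHigman

/-! ### Algebras with a multiplication table of bounded degree -/

section Table

variable {Γ : Type*} [Group Γ] {S A : Type*} [CommRing S] [CommRing A] [Algebra S A]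

/-! The coefficient of `z` in $K_\lambda(n)K_\mu(n)$ is the number of factorizations $z=xy$ with
$x,y$ of modified types $\lambda,\mu$. Sort them by
$U=\mathrm{supp}\,x\cup\mathrm{supp}\,y\supseteq\mathrm{supp}\,z$. The number with a given $U$ is
invariant under conjugation and under adjoining idle points, so it depends only on the modified type
$\nu$ of $z$ and on $k=|U|-|\mathrm{supp}\,z|$ (`exactCount_eq`). There are
$\binom{n-|\mathrm{supp}\,z|}{k}$ sets $U$ for each $k$, and
$|\mathrm{supp}\,z|=\|\nu\|+\ell(\nu(c^0))$ (`supportSize_modifiedType`). Hence the coefficient is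
the value at $n$ of an integral combination of binomial polynomials (`card_factorizations`). It is
unique because $K_\nu(n)\ne0$ for all large $n$ and a polynomial with infinitely many zeros
vanishes.

The bounds on degrees imitate reflection length. $\Gamma_n$ acts on functions
$\{1,\dots,n\}\to\Gamma\cup\{0\}$, and $x$ fixes $(|\Gamma|+1)^{n-\|x\|}$ of them, $\|x\|$ being the
degree of its modified type (`ncard_fixed`, `degree_modifiedType`). Moving reflections one at a time
from $y$ to $x$ yields the analogue of: the codimension of the fixed space is subadditive, and in
the case of equality $\mathrm{Fix}(xy)\subseteq\mathrm{Fix}(x)$ (`ncard_fixed_mul_le`). So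
$\|xy\|\le\|x\|+\|y\|$, and equality forces
$\mathrm{supp}\,x,\mathrm{supp}\,y\subseteq\mathrm{supp}\,xy$. In top degree only $k=0$ survives,
and the polynomial is a constant natural number.

No associativity has to be checked on tables. $\mathcal F_\Gamma$ is found inside $\prod_n
R_{\mathbb Z}(\Gamma_n)$, where $p\in R$ acts on the $n$-th factor as $p(n)$, and $\mathcal
G_\Gamma$ inside $\prod_n\mathcal G_\Gamma(n)$. The graded ring of $\mathcal F_\Gamma$ and
$R\otimes\mathcal G_\Gamma$ are isomorphic since they have bases with the same table. -/

theorem degree_zero : PartFun.degree (0 : PartFun Γ) = 0 := by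
  simp [PartFun.degree]

theorem supportSize_zero : PartFun.supportSize (0 : PartFun Γ) = 0 := by
  simp [PartFun.supportSize, degree_zero]

theorem degFil_mono (b : PartFun Γ → A) : Monotone (degFil S b) := fun _ _ hij =>
  Submodule.span_mono (Set.image_mono fun _ hμ => le_trans (Set.mem_ofPred.1 hμ) hij)

theorem filLT_degFil_le (b : PartFun Γ → A) (d : ℕ) :
    filLT (degFil S b) d ≤ Submodule.span S (b '' {μ | μ.degree < d}) :=
  iSup₂_le fun _ hi => Submodule.span_mono (Set.image_mono fun _ hμ => lt_of_le_of_lt hμ hi)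

theorem mem_degFil_of_le (b : PartFun Γ → A) {μ : PartFun Γ} {d : ℕ} (h : μ.degree ≤ d) :
    b μ ∈ degFil S b d :=
  degFil_mono b h (mem_degFil b μ)

theorem mem_filLT_of_lt (b : PartFun Γ → A) {μ : PartFun Γ} {d : ℕ} (h : μ.degree < d) :
    b μ ∈ filLT (degFil S b) d :=
  (le_iSup₂_of_le (f := fun i (_ : i < d) => degFil S b i) μ.degree h le_rfl) (mem_degFil b μ)

/-- Products of generators are controlled by the table, and `b 0` supplies the unit in degree 0. The
same lemma serves the class algebras over `ℤ` and $\mathcal F_\Gamma$ over $R$. -/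
theorem isRingFiltration_degFil {b : PartFun Γ → A} {c : PartFun Γ → PartFun Γ → PartFun Γ →₀ S}
    (hb : HasMulTable b c) (hone : b 0 = 1)
    (hc : ∀ l m ν, c l m ν ≠ 0 → ν.degree ≤ l.degree + m.degree) :
    IsRingFiltration (degFil S b) (filLT (degFil S b)) where
  mono := degFil_mono b
  is_le {i j} hij := le_iSup₂_of_le (f := fun i (_ : i < j) => degFil S b i) i hij le_rfl
  is_sup B j h := iSup₂_le h
  one_mem := hone ▸ mem_degFil_of_le b degree_zero.le
  mul_mem {i j} x y hx hy := by
    have h : degFil S b i * degFil S b j ≤ degFil S b (i + j) := by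
      unfold degFil
      rw [Submodule.span_mul_span, Submodule.span_le]
      rintro _ ⟨_, ⟨l, hl, rfl⟩, _, ⟨m, hm, rfl⟩, rfl⟩
      change b l * b m ∈ degFil S b (i + j)
      rw [hb l m]
      refine Submodule.sum_mem _ fun ν hν => Submodule.smul_mem _ _ (mem_degFil_of_le b ?_)
      exact (hc l m ν (Finsupp.mem_support_iff.1 hν)).trans (add_le_add hl hm)
    exact h (Submodule.mul_mem_mul hx hy)

/-- The symbol map in degree `d`, as a linear map. -/
def symbₗ (F : ℕ → Submodule S A) (d : ℕ) : F d →ₗ[S] AssocGr F :=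
  DirectSum.lof S ℕ (GrPiece F) d ∘ₗ grMk F d

open scoped Classical in
/-- The element `b μ` of the `d`-th term of the filtration, or `0` if `d < ‖μ‖`. -/
def truncate (S : Type*) [CommRing S] [Algebra S A] (b : PartFun Γ → A) (d : ℕ) (μ : PartFun Γ) :
    degFil S b d :=
  if h : μ.degree ≤ d then ⟨b μ, mem_degFil_of_le b h⟩ else 0

theorem coe_truncate (b : PartFun Γ → A) {d : ℕ} {μ : PartFun Γ} (h : μ.degree ≤ d) :
    (truncate S b d μ : A) = b μ := by
  simp [truncate, h]

theorem grMk_truncate_of_lt (b : PartFun Γ → A) {d : ℕ} {μ : PartFun Γ} (h : μ.degree < d) :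
    grMk (degFil S b) d (truncate S b d μ) = 0 := by
  rw [grMk_eq_zero, coe_truncate b h.le]
  exact mem_filLT_of_lt b h

theorem symbₗ_truncate (b : PartFun Γ → A) (μ : PartFun Γ) :
    symbₗ (degFil S b) μ.degree (truncate S b μ.degree μ) = grClass S b μ := by
  simp [truncate, symbₗ, grClass, symb, DirectSum.lof_eq_of]

theorem symbₗ_truncate_of_lt (b : PartFun Γ → A) {d : ℕ} {μ : PartFun Γ} (h : μ.degree < d) :
    symbₗ (degFil S b) d (truncate S b d μ) = 0 := by
  rw [symbₗ, LinearMap.comp_apply, grMk_truncate_of_lt b h, map_zero]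

theorem grClass_eq_zero {b : PartFun Γ → A} {μ : PartFun Γ} (h : b μ = 0) :
    grClass S b μ = 0 := by
  have : (⟨b μ, mem_degFil b μ⟩ : degFil S b μ.degree) = 0 := Subtype.ext h
  rw [grClass, symb, this, map_zero, map_zero]

theorem grClass_zero_eq_one {b : PartFun Γ → A}
    [IsRingFiltration (degFil S b) (filLT (degFil S b))] (hone : b 0 = 1) :
    grClass S b 0 = 1 := by
  have key : ∀ (d : ℕ) (h : b 0 ∈ degFil S b d), d = 0 →
      symb (degFil S b) d (b 0) h = DirectSum.of (GrPiece (degFil S b)) 0 (grOne _) := by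
    rintro d h rfl
    unfold symb grOne
    congr 2
    exact Subtype.ext hone
  exact key _ _ degree_zero

/-- Entries of the table below the top degree die in the quotient and entries above it are zero, so
only those of exact degree remain. The truncated table `a` has entries in `ℕ`, so that one and the
same table makes sense over every `S`. -/
theorem hasMulTable_grClass {b : PartFun Γ → A} {c : PartFun Γ → PartFun Γ → PartFun Γ →₀ S}
    [IsRingFiltration (degFil S b) (filLT (degFil S b))] (hb : HasMulTable b c)
    (hc : ∀ l m ν, c l m ν ≠ 0 → ν.degree ≤ l.degree + m.degree)
    {a : PartFun Γ → PartFun Γ → PartFun Γ →₀ ℕ}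
    (ha : ∀ l m ν, a l m ν ≠ 0 → ν.degree = l.degree + m.degree)
    (hca : ∀ l m ν, ν.degree = l.degree + m.degree → c l m ν = (a l m ν : S)) :
    HasMulTable (grClass S b) a := by
  classical
  intro l m
  have h1 : grClass S b l * grClass S b m = symbₗ (degFil S b) (l.degree + m.degree)
      ⟨b l * b m, SetLike.mul_mem_graded (mem_degFil b l) (mem_degFil b m)⟩ := by
    unfold grClass symb
    rw [DirectSum.of_mul_of]
    rfl
  have h2 : (⟨b l * b m, SetLike.mul_mem_graded (mem_degFil b l) (mem_degFil b m)⟩ :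
      degFil S b (l.degree + m.degree)) =
      ∑ ν ∈ (c l m).support ∪ (a l m).support,
        c l m ν • truncate S b (l.degree + m.degree) ν := by
    refine Subtype.ext ?_
    change b l * b m = _
    rw [hb l m, Finsupp.sum_of_support_subset _ Finset.subset_union_left _ (by simp)]
    rw [AddSubmonoidClass.coe_finsetSum]
    refine Finset.sum_congr rfl fun ν _ => ?_
    by_cases h : c l m ν = 0
    · simp [h]
    · rw [Submodule.coe_smul, coe_truncate b (hc _ _ _ h)]
  rw [h1, h2, map_sum, Finsupp.sum_of_support_subset _ Finset.subset_union_right _ (by simp)]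
  refine Finset.sum_congr rfl fun ν _ => ?_
  rw [map_smul]
  rcases lt_trichotomy ν.degree (l.degree + m.degree) with h | h | h
  · rw [symbₗ_truncate_of_lt b h, smul_zero]
    have : a l m ν = 0 := by
      by_contra h'
      exact h.ne (ha _ _ _ h')
    rw [this, zero_smul]
  · rw [← h, symbₗ_truncate, hca _ _ _ h, Nat.cast_smul_eq_nsmul]
  · have : a l m ν = 0 := by
      by_contra h'
      exact h.ne' (ha _ _ _ h')
    have h3 : c l m ν = 0 := by
      by_contra h'
      exact h.not_ge (hc _ _ _ h')
    rw [this, zero_smul, h3, zero_smul]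

/-- The component of degree `d` of a relation says that a combination of members of degree exactly
`d` lies in the span of those of smaller degree; for an independent family these spans meet only in
0. The predicate `p` is there because $K_\mu(n)$ vanishes for all but finitely many $\mu$. -/
theorem linearIndependent_grClass {b : PartFun Γ → A} (p : PartFun Γ → Prop)
    (hp : ∀ μ, ¬ p μ → b μ = 0) (hli : LinearIndependent S fun μ : {μ // p μ} => b μ) :
    LinearIndependent S fun μ : {μ // p μ} => grClass S b (μ : PartFun Γ) := by
  classical
  rw [linearIndependent_iff']
  intro s g hg i hi
  set d := (i : PartFun Γ).degree with hd
  set t := s.filter fun μ : {μ // p μ} => (μ : PartFun Γ).degree = d with ht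
  have h1 : grMk (degFil S b) d (∑ μ ∈ t, g μ • truncate S b d (μ : PartFun Γ)) = 0 := by
    have := congrArg (DirectSum.component S ℕ (GrPiece (degFil S b)) d) hg
    rw [map_sum, map_zero] at this
    rw [← this, map_sum, ht, Finset.sum_filter]
    refine Finset.sum_congr rfl fun μ _ => ?_
    rw [map_smul, map_smul]
    split_ifs with h
    · rw [← h, ← symbₗ_truncate, symbₗ, LinearMap.comp_apply, DirectSum.component.lof_self]
    · rw [grClass, symb, ← DirectSum.lof_eq_of S, DirectSum.component.of, dif_neg h, smul_zero]
  rw [grMk_eq_zero] at h1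
  have h2 : ((∑ μ ∈ t, g μ • truncate S b d (μ : PartFun Γ) : degFil S b d) : A) = ∑ μ ∈ t, g μ • b μ := by
    rw [AddSubmonoidClass.coe_finsetSum]
    refine Finset.sum_congr rfl fun μ hμ => ?_
    rw [Submodule.coe_smul, coe_truncate b (Finset.mem_filter.1 hμ).2.le]
  rw [h2] at h1
  have h3 : Submodule.span S (b '' {μ | μ.degree < d}) ≤
      Submodule.span S ((fun μ : {μ // p μ} => b μ) '' {μ | (μ : PartFun Γ).degree < d}) := by
    rw [Submodule.span_le]
    rintro _ ⟨μ, hμ, rfl⟩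
    by_cases h : p μ
    · exact Submodule.subset_span ⟨⟨μ, h⟩, hμ, rfl⟩
    · rw [hp μ h]
      exact Submodule.zero_mem _
  have h4 := h3 (filLT_degFil_le b d h1)
  have h5 : ∑ μ ∈ t, g μ • b μ ∈
      Submodule.span S ((fun μ : {μ // p μ} => b μ) '' {μ | (μ : PartFun Γ).degree = d}) :=
    Submodule.sum_mem _ fun μ hμ => Submodule.smul_mem _ _
      (Submodule.subset_span ⟨μ, (Finset.mem_filter.1 hμ).2, rfl⟩)
  have h6 : Disjoint {μ : {μ // p μ} | (μ : PartFun Γ).degree = d}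
      {μ | (μ : PartFun Γ).degree < d} := by
    rw [Set.disjoint_left]
    intro μ h h'
    exact absurd h (ne_of_lt h')
  have h7 := (Submodule.disjoint_def.1 (hli.disjoint_span_image h6)) _ h5 h4
  exact linearIndependent_iff'.1 hli t g h7 i (Finset.mem_filter.2 ⟨hi, rfl⟩)

/-- The component of degree `d` of the associated graded ring is spanned by the classes of
degree `d`. -/
theorem range_lof_degFil (b : PartFun Γ → A) (d : ℕ) :
    LinearMap.range (DirectSum.lof S ℕ (GrPiece (degFil S b)) d) =
      Submodule.span S {t | ∃ μ : PartFun Γ, μ.degree = d ∧ t = grClass S b μ} := by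
  apply le_antisymm
  · rintro _ ⟨x, rfl⟩
    obtain ⟨⟨a, ha⟩, rfl⟩ := grMk_surjective _ d x
    change symbₗ (degFil S b) d ⟨a, ha⟩ ∈ _
    induction ha using Submodule.span_induction with
    | mem x hx =>
      obtain ⟨μ, hμ, rfl⟩ := hx
      have h : (⟨b μ, mem_degFil_of_le b hμ⟩ : degFil S b d) = truncate S b d μ :=
        Subtype.ext (coe_truncate b hμ).symm
      change symbₗ (degFil S b) d (⟨b μ, mem_degFil_of_le b hμ⟩ : degFil S b d) ∈ _
      rw [h]
      rcases lt_or_eq_of_le (Set.mem_ofPred.1 hμ) with h' | rfl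
      · rw [symbₗ_truncate_of_lt b h']
        exact Submodule.zero_mem _
      · rw [symbₗ_truncate]
        exact Submodule.subset_span ⟨μ, rfl, rfl⟩
    | zero => exact (map_zero (symbₗ (degFil S b) d)).symm ▸ Submodule.zero_mem _
    | add x y hx hy h1 h2 =>
      have := Submodule.add_mem _ h1 h2
      rwa [← map_add] at this
    | smul r x hx h1 =>
      have := Submodule.smul_mem _ r h1
      rwa [← map_smul] at this
  · rw [Submodule.span_le]
    rintro _ ⟨μ, rfl, rfl⟩
    exact ⟨_, rfl⟩

theorem span_grClass (b : PartFun Γ → A) :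
    Submodule.span S (Set.range (grClass S b)) = ⊤ := by
  rw [eq_top_iff]
  rintro x -
  induction x using DirectSum.induction_on with
  | zero => exact Submodule.zero_mem _
  | add x y hx hy => exact Submodule.add_mem _ hx hy
  | of d x =>
    have h := (range_lof_degFil (S := S) b d).le ⟨x, rfl⟩
    refine Submodule.span_mono ?_ h
    rintro _ ⟨μ, -, rfl⟩
    exact ⟨μ, rfl⟩

/-- The classes of the non-zero members of a linearly independent family form a basis of the
associated graded ring. -/
def grBasis (b : PartFun Γ → A) (p : PartFun Γ → Prop)
    (hp : ∀ μ, ¬ p μ → b μ = 0) (hli : LinearIndependent S fun μ : {μ // p μ} => b μ) :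
    Module.Basis {μ // p μ} S (AssocGr (degFil S b)) :=
  Module.Basis.mk (linearIndependent_grClass p hp hli) (by
    rw [← span_grClass, Submodule.span_le]
    rintro _ ⟨μ, rfl⟩
    by_cases h : p μ
    · exact Submodule.subset_span ⟨⟨μ, h⟩, rfl⟩
    · rw [grClass_eq_zero (hp μ h)]
      exact Submodule.zero_mem _)

theorem grBasis_apply (b : PartFun Γ → A) (p : PartFun Γ → Prop)
    (hp : ∀ μ, ¬ p μ → b μ = 0) (hli : LinearIndependent S fun μ : {μ // p μ} => b μ)
    (μ : {μ // p μ}) : grBasis b p hp hli μ = grClass S b (μ : PartFun Γ) := by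
  rw [grBasis, Module.Basis.mk_apply]

end Table

/-! ### Counting points in cycles -/

section Cycles

open scoped Classical in
/-- The points at which `x = (g, σ)` is non-trivial: `σ i ≠ i` or `g i ≠ 1`. -/
def supp {Γ : Type*} [Group Γ] {n : ℕ} (x : Wreath Γ n) : Finset (Fin n) :=
  Finset.univ.filter fun i => ¬ (x.right i = i ∧ x.left i = 1)

variable {Γ : Type*} [Group Γ] {n : ℕ}

theorem notMem_supp {x : Wreath Γ n} {i : Fin n} :
    i ∉ supp x ↔ x.right i = i ∧ x.left i = 1 := by
  simp [supp]

theorem mem_supp {x : Wreath Γ n} {i : Fin n} :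
    i ∈ supp x ↔ ¬ (x.right i = i ∧ x.left i = 1) := by
  simp [supp]

theorem cycleLen_eq_one {x : Wreath Γ n} {i : Fin n} : cycleLen x i = 1 ↔ x.right i = i := by
  rw [← PNat.coe_inj]
  exact Function.minimalPeriod_eq_one_iff_isFixedPt

theorem notMem_supp_iff_cycle {x : Wreath Γ n} {i : Fin n} :
    i ∉ supp x ↔ cycleClass x i = 1 ∧ cycleLen x i = 1 := by
  rw [notMem_supp, cycleLen_eq_one, and_comm (a := cycleClass x i = 1)]
  refine and_congr_right fun h => ?_
  have h1 : cycleLen x i = 1 := cycleLen_eq_one.2 h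
  rw [cycleClass, h1, ConjClasses.one_eq_mk_one, ConjClasses.mk_eq_mk_iff_isConj, isConj_comm,
    isConj_one_right]
  simp [pathProd]

theorem right_pow_eq_iff (x : Wreath Γ n) (i : Fin n) (k l : ℕ) :
    (x.right ^ k) i = (x.right ^ l) i ↔ k ≡ l [MOD (cycleLen x i : ℕ)] := by
  have := Function.iterate_injOn_Iio_minimalPeriod (f := x.right) (x := i)
  rw [Equiv.Perm.coe_pow, Equiv.Perm.coe_pow,
    ← Function.iterate_mod_minimalPeriod_eq (f := x.right) (n := k),
    ← Function.iterate_mod_minimalPeriod_eq (f := x.right) (n := l)]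
  have hpos : 0 < Function.minimalPeriod x.right i := (cycleLen x i).pos
  constructor
  · intro h
    exact this (Nat.mod_lt _ hpos) (Nat.mod_lt _ hpos) h
  · intro h
    have h' : k % Function.minimalPeriod x.right i = l % Function.minimalPeriod x.right i := h
    rw [h']

theorem card_sameCycle [DecidableEq (Fin n)] (x : Wreath Γ n) (i : Fin n)
    [DecidablePred fun j => x.right.SameCycle j i] :
    (Finset.univ.filter fun j => x.right.SameCycle j i).card = cycleLen x i := by
  rw [← Finset.card_range (cycleLen x i : ℕ)]
  symm
  refine Finset.card_bij (fun k _ => (x.right ^ k) i) ?_ ?_ ?_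
  · intro k _
    rw [Finset.mem_filter]
    exact ⟨Finset.mem_univ _, Equiv.Perm.SameCycle.symm ⟨k, by simp⟩⟩
  · intro k hk l hl h
    rw [right_pow_eq_iff] at h
    exact Nat.ModEq.eq_of_lt_of_lt h (Finset.mem_range.1 hk) (Finset.mem_range.1 hl)
  · intro j hj
    obtain ⟨k, rfl⟩ := ((Finset.mem_filter.1 hj).2.symm).exists_nat_pow_eq
    refine ⟨k % cycleLen x i, Finset.mem_range.2 (Nat.mod_lt _ (cycleLen x i).pos), ?_⟩
    rw [right_pow_eq_iff]
    exact Nat.mod_modEq _ _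

/-- The cycle of `σ` through a point, for `x = (g, σ)`. -/
def Cycles.of (x : Wreath Γ n) (i : Fin n) : Cycles x :=
  Quotient.mk (Equiv.Perm.SameCycle.setoid x.right) i

theorem Cycles.of_eq {x : Wreath Γ n} {i j : Fin n} :
    Cycles.of x i = Cycles.of x j ↔ x.right.SameCycle i j :=
  Quotient.eq (r := Equiv.Perm.SameCycle.setoid x.right)

@[simp] theorem Cycles.len_of (x : Wreath Γ n) (i : Fin n) :
    Cycles.len x (Cycles.of x i) = cycleLen x i := rfl

@[simp] theorem Cycles.prodClass_of (x : Wreath Γ n) (i : Fin n) :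
    Cycles.prodClass x (Cycles.of x i) = cycleClass x i := rfl

/-- A sum over points is a sum over cycles, weighted by their lengths. -/
theorem sum_points (x : Wreath Γ n) (F : Cycles x → ℕ) :
    ∑ i, F (Cycles.of x i) = ∑ y, (Cycles.len x y : ℕ) * F y := by
  classical
  rw [← Finset.sum_fiberwise (Finset.univ : Finset (Fin n)) (Cycles.of x)]
  refine Finset.sum_congr rfl fun y _ => ?_
  obtain ⟨i, rfl⟩ : ∃ i, Cycles.of x i = y := Quotient.exists_rep y
  rw [Finset.sum_congr rfl (g := fun _ => F (Cycles.of x i))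
    fun j hj => congrArg F (Finset.mem_filter.1 hj).2, Finset.sum_const, smul_eq_mul,
    Cycles.len_of, ← card_sameCycle x i]
  simp_rw [Cycles.of_eq]

open scoped Classical in
/-- The number of points on the cycles of length `k` with cycle-product in `c`. -/
def pointCount (x : Wreath Γ n) (c : ConjClasses Γ) (k : ℕ+) : ℕ :=
  (Finset.univ.filter fun i => cycleClass x i = c ∧ cycleLen x i = k).card

theorem count_typeOf [DecidableEq (ConjClasses Γ)] (x : Wreath Γ n)
    (c : ConjClasses Γ) (k : ℕ+) :
    (typeOf x c).count k =
      (Finset.univ.filter fun y => Cycles.prodClass x y = c ∧ Cycles.len x y = k).card := by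
  rw [typeOf, Multiset.count_map, Finset.card_def, ← Finset.filter_filter, Finset.filter_val]
  congr 1
  · simp [eq_comm]

/-- Counting points instead of cycles replaces bijections between quotients, for different elements
or different `n`, by equalities of cardinalities of sets of points. -/
theorem pointCount_eq (x : Wreath Γ n) (c : ConjClasses Γ) (k : ℕ+) :
    pointCount x c k = k * (typeOf x c).count k := by
  classical
  have := sum_points x fun y => if Cycles.prodClass x y = c ∧ Cycles.len x y = k then 1 else 0
  simp only [Cycles.prodClass_of, Cycles.len_of, mul_ite, mul_one,
    mul_zero] at this
  refine Eq.trans ?_ (this.trans ?_)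
  · rw [pointCount, Finset.card_filter]
    exact Finset.sum_congr rfl fun i _ => if_congr Iff.rfl rfl rfl
  rw [← Finset.sum_filter,
    Finset.sum_congr rfl (g := fun _ => (k : ℕ)) fun y hy => by rw [(Finset.mem_filter.1 hy).2.2],
    Finset.sum_const, smul_eq_mul, mul_comm, count_typeOf]

open scoped Classical in
/-- The length of the cycles that are recorded by a part `k` of `μ(c)`, where `μ` is the
modified type. -/
def unshift (c : ConjClasses Γ) (k : ℕ+) : ℕ+ := if c = 1 then k + 1 else k

theorem unshift_ne (c : ConjClasses Γ) (k : ℕ+) : ¬ (c = 1 ∧ unshift c k = 1) := by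
  rintro ⟨h, h'⟩
  rw [unshift, if_pos h, ← PNat.coe_inj] at h'
  have := k.pos
  simp at h'

theorem exists_unshift {c : ConjClasses Γ} {k : ℕ+} (h : ¬ (c = 1 ∧ k = 1)) :
    ∃ k', unshift c k' = k := by
  by_cases hc : c = 1
  · have hk : 1 < k := lt_of_le_of_ne one_le fun h' => h ⟨hc, h'.symm⟩
    exact ⟨k - 1, by rw [unshift, if_pos hc, PNat.sub_add_of_lt hk]⟩
  · exact ⟨k, by rw [unshift, if_neg hc]⟩

theorem count_modifiedType (x : Wreath Γ n) (c : ConjClasses Γ) (k : ℕ+) :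
    (modifiedType x c).count k = (typeOf x c).count (unshift c k) := by
  by_cases h : c = 1
  · rw [modifiedType, if_pos h, unshift, if_pos h, Multiset.count_map, Multiset.count,
      Multiset.countP_eq_card_filter, Multiset.filter_filter]
    congr 1
    refine Multiset.filter_congr fun l _ => ?_
    constructor
    · rintro ⟨rfl, hl⟩
      rw [PNat.sub_add_of_lt hl]
    · rintro rfl
      exact ⟨(PNat.add_sub).symm, PNat.lt_add_left 1 k⟩
  · rw [modifiedType, if_neg h, unshift, if_neg h]

theorem pointCount_unshift (x : Wreath Γ n) (c : ConjClasses Γ) (k : ℕ+) :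
    pointCount x c (unshift c k) = unshift c k * (modifiedType x c).count k := by
  rw [pointCount_eq, count_modifiedType]

/-- The excluded pair records the trivial points, exactly the information that the modified type
forgets; this is why `n` and `m` may differ. -/
theorem modifiedType_eq_iff {m : ℕ} (x : Wreath Γ n) (y : Wreath Γ m) :
    modifiedType x = modifiedType y ↔
      ∀ c k, ¬ (c = 1 ∧ k = 1) → pointCount x c k = pointCount y c k := by
  classical
  constructor
  · intro h c k hck
    obtain ⟨k, rfl⟩ := exists_unshift hck
    rw [pointCount_unshift, pointCount_unshift, h]
  · intro h
    funext c
    refine Multiset.ext.2 fun k => ?_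
    have := h c _ (unshift_ne c k)
    rw [pointCount_unshift, pointCount_unshift] at this
    exact Nat.eq_of_mul_eq_mul_left (unshift c k).pos this

theorem sum_len (x : Wreath Γ n) : ∑ y, (Cycles.len x y : ℕ) = n := by
  simpa using (sum_points x fun _ => 1).symm

open scoped Classical in
/-- The cycles with trivial cycle-product. -/
def balanced (x : Wreath Γ n) : Finset (Cycles x) :=
  Finset.univ.filter fun y => Cycles.prodClass x y = 1

theorem mem_balanced {x : Wreath Γ n} {y : Cycles x} :
    y ∈ balanced x ↔ Cycles.prodClass x y = 1 := by
  simp [balanced]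

theorem card_supp_add_pointCount (x : Wreath Γ n) : (supp x).card + pointCount x 1 1 = n := by
  classical
  have := Finset.card_filter_add_card_filter_not (s := (Finset.univ : Finset (Fin n)))
    (fun i => i ∈ supp x)
  simp only [Finset.card_univ, Fintype.card_fin] at this
  rw [pointCount]
  simp_rw [← notMem_supp_iff_cycle]
  simpa using this

theorem sum_modifiedType (x : Wreath Γ n) (c : ConjClasses Γ) [DecidableEq (ConjClasses Γ)] :
    ((modifiedType x c).map fun k : ℕ+ => (k : ℕ)).sum =
      ∑ y with Cycles.prodClass x y = c,
        ((Cycles.len x y : ℕ) - if Cycles.prodClass x y = 1 then 1 else 0) := by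
  rw [Finset.sum_congr rfl (g := fun y => (Cycles.len x y : ℕ) - if c = 1 then 1 else 0)
    fun y hy => by rw [(Finset.mem_filter.1 hy).2]]
  by_cases h : c = 1
  · rw [modifiedType, if_pos h, if_pos h, typeOf, Multiset.map_map]
    have key : ∀ s : Multiset ℕ+, ((s.filter fun k => 1 < k).map
        ((fun k : ℕ+ => (k : ℕ)) ∘ fun k => k - 1)).sum = (s.map fun k : ℕ+ => (k : ℕ) - 1).sum := by
      intro s
      induction s using Multiset.induction_on with
      | empty => simp
      | cons a s ih =>
        by_cases ha : 1 < a
        · rw [Multiset.filter_cons_of_pos _ ha]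
          simp only [Multiset.map_cons, Multiset.sum_cons, ih]
          simp [PNat.sub_coe, ha]
        · rw [Multiset.filter_cons_of_neg _ ha, ih]
          have : a = 1 := le_antisymm (not_lt.1 ha) one_le
          simp [this]
    rw [key, Multiset.map_map]
    simp only [Finset.sum]
    congr!
  · rw [modifiedType, if_neg h, if_neg h, typeOf, Multiset.map_map]
    simp only [Finset.sum]
    congr!

variable [Finite Γ]

/-- A cycle contributes its length to the degree, less 1 if its cycle-product is trivial, and the
lengths add up to `n`. -/
theorem degree_modifiedType (x : Wreath Γ n) :
    (modifiedType x).degree + (balanced x).card = n := by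
  classical
  have : Finite (ConjClasses Γ) := Quotient.finite _
  let _ := Fintype.ofFinite (ConjClasses Γ)
  rw [PartFun.degree, finsum_eq_sum_of_fintype]
  simp_rw [sum_modifiedType]
  rw [Finset.sum_fiberwise (Finset.univ : Finset (Cycles x)) (Cycles.prodClass x)
    (fun y => (Cycles.len x y : ℕ) - if Cycles.prodClass x y = 1 then 1 else 0)]
  have h : (balanced x).card = ∑ y, if Cycles.prodClass x y = 1 then 1 else 0 := by
    rw [Finset.sum_boole, balanced]
    simp
  rw [h, ← Finset.sum_add_distrib]
  refine Eq.trans ?_ (sum_len x)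
  refine Finset.sum_congr rfl fun y _ => Nat.sub_add_cancel ?_
  have := (Cycles.len x y).pos
  split_ifs <;> omega

/-- Counting one more for each part at the identity class undoes the diminution of the nontrivial
cycles with trivial cycle-product. -/
theorem supportSize_modifiedType (x : Wreath Γ n) :
    (modifiedType x).supportSize = (supp x).card := by
  classical
  have h1 := degree_modifiedType x
  have h2 := card_supp_add_pointCount x
  have h3 : (modifiedType x 1).card + (typeOf x 1).count 1 = (balanced x).card := by
    rw [modifiedType, if_pos rfl, Multiset.card_map, Multiset.count,
      Multiset.countP_eq_card_filter, add_comm]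
    have : (typeOf x 1).card = (balanced x).card := by
      rw [typeOf, Multiset.card_map, balanced, Finset.card_def]
    rw [← this, ← Multiset.card_add]
    have h4 : (typeOf x 1).filter (fun k => 1 < k) = (typeOf x 1).filter (fun k => ¬ 1 = k) :=
      Multiset.filter_congr fun k _ => by
        rw [lt_iff_le_and_ne]
        exact and_iff_right one_le
    rw [h4, Multiset.filter_add_not]
  have h5 := pointCount_eq x 1 1
  rw [PNat.one_coe, one_mul] at h5
  rw [PartFun.supportSize]
  omega

end Cycles

/-! ### Conjugacy in wreath products -/

section Conjugacy

theorem exists_equiv_of_card_fiber {α β γ : Type*} [Fintype α] [Fintype β] [DecidableEq γ]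
    (f : α → γ) (g : β → γ)
    (h : ∀ c, (Finset.univ.filter fun a => f a = c).card =
      (Finset.univ.filter fun b => g b = c).card) :
    ∃ e : α ≃ β, ∀ a, g (e a) = f a := by
  have h' : ∀ c, Nonempty ({a // f a = c} ≃ {b // g b = c}) := fun c => by
    refine Fintype.card_eq.1 ?_
    rw [Fintype.card_subtype, Fintype.card_subtype, h]
  refine ⟨(Equiv.sigmaFiberEquiv f).symm.trans
    ((Equiv.sigmaCongrRight fun c => (h' c).some).trans (Equiv.sigmaFiberEquiv g)), fun a => ?_⟩
  exact ((h' (f a)).some ⟨a, rfl⟩).2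

variable {Γ : Type*} [Group Γ] {n : ℕ}

theorem mul_left_apply (x y : Wreath Γ n) (i : Fin n) :
    (x * y).left i = x.left i * y.left (x.right⁻¹ i) := rfl

theorem mul_right_apply (x y : Wreath Γ n) (i : Fin n) :
    (x * y).right i = x.right (y.right i) := rfl

theorem pathProd_add (x : Wreath Γ n) (i : Fin n) (k l : ℕ) :
    pathProd x i (k + l) = pathProd x ((x.right ^ k) i) l * pathProd x i k := by
  induction l with
  | zero => simp [pathProd]
  | succ l ih =>
    rw [← add_assoc, pathProd, ih, pathProd, mul_assoc, add_comm k l, pow_add]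
    rfl

theorem pathProd_cycleLen_add (x : Wreath Γ n) (i : Fin n) (k : ℕ) :
    pathProd x i (k + cycleLen x i) = pathProd x i k * pathProd x i (cycleLen x i) := by
  rw [add_comm, pathProd_add, pow_cycleLen]

theorem eq_of_modEq {α : Type*} {f : ℕ → α} {L : ℕ} (hf : ∀ k, f (k + L) = f k) {k l : ℕ}
    (h : k ≡ l [MOD L]) : f k = f l := by
  have hf' : Function.Periodic f L := hf
  rw [← hf'.map_mod_nat k, ← hf'.map_mod_nat l]
  exact congrArg f h

/-- Cycles are matched by length and class. A conjugating element is then propagated along each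
cycle from a base point, and it closes up because its value there conjugates one cycle-product into
the other. -/
theorem exists_conj_of_typeOf_eq {x x' : Wreath Γ n} (h : typeOf x = typeOf x') :
    ∃ z : Wreath Γ n, z * x * z⁻¹ = x' := by
  classical
  obtain ⟨e, he⟩ := exists_equiv_of_card_fiber
    (fun y : Cycles x => (Cycles.prodClass x y, Cycles.len x y))
    (fun y : Cycles x' => (Cycles.prodClass x' y, Cycles.len x' y)) (by
      rintro ⟨c, k⟩
      simp only [Prod.mk.injEq]
      rw [← count_typeOf, ← count_typeOf, h])
  have hof : ∀ y : Cycles x, Cycles.of x y.out = y := fun y => Quotient.out_eq y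
  have hof' : ∀ y : Cycles x', Cycles.of x' y.out = y := fun y => Quotient.out_eq y
  have hlen : ∀ y : Cycles x, cycleLen x' (e y).out = cycleLen x y.out := fun y =>
    (congrArg (Cycles.len x') (hof' (e y))).trans
      ((congrArg Prod.snd (he y)).trans (congrArg (Cycles.len x) (hof y)).symm)
  have hclass : ∀ y : Cycles x, ∃ t : Γ, t * pathProd x y.out (cycleLen x y.out) * t⁻¹ =
      pathProd x' (e y).out (cycleLen x y.out) := fun y => by
    have : cycleClass x' (e y).out = cycleClass x y.out :=
      (congrArg (Cycles.prodClass x') (hof' (e y))).trans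
        ((congrArg Prod.fst (he y)).trans (congrArg (Cycles.prodClass x) (hof y)).symm)
    rw [cycleClass, cycleClass, hlen, ConjClasses.mk_eq_mk_iff_isConj, isConj_comm,
      isConj_iff] at this
    exact this
  choose t ht using hclass
  have hk : ∀ j : Fin n, ∃ k : ℕ, (x.right ^ k) (Cycles.of x j).out = j := fun j =>
    (Cycles.of_eq.1 (hof (Cycles.of x j))).exists_nat_pow_eq
  choose k hk using hk
  -- This is the only solution along a cycle, with initial value `t y`, of the relation `huσ` below.
  -- The exponents `k j` are arbitrary choices, harmless because `U y` is periodic (`hU`).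
  let U : Cycles x → ℕ → Γ := fun y l =>
    pathProd x' (e y).out l * t y * (pathProd x y.out l)⁻¹
  let p : Fin n → Fin n := fun j => (x'.right ^ k j) (e (Cycles.of x j)).out
  let u : Fin n → Γ := fun j => U (Cycles.of x j) (k j)
  have hU : ∀ y l, U y (l + cycleLen x y.out) = U y l := fun y l => by
    simp only [U]
    rw [pathProd_cycleLen_add]
    have := pathProd_cycleLen_add x' (e y).out l
    rw [hlen] at this
    rw [this, ← ht]
    group
  have hofpow : ∀ (y : Cycles x) l, Cycles.of x ((x.right ^ l) y.out) = y := fun y l => by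
    conv_rhs => rw [← hof y]
    exact Cycles.of_eq.2 (Equiv.Perm.SameCycle.symm ⟨l, by simp⟩)
  have hmod : ∀ (y : Cycles x) l, k ((x.right ^ l) y.out) ≡ l [MOD cycleLen x y.out] :=
    fun y l => by
      have := hk ((x.right ^ l) y.out)
      rw [hofpow] at this
      exact (right_pow_eq_iff _ _ _ _).1 this
  have hp : ∀ (y : Cycles x) l, p ((x.right ^ l) y.out) = (x'.right ^ l) (e y).out :=
    fun y l => by
      simp only [p]
      rw [hofpow, right_pow_eq_iff, hlen]
      exact hmod y l
  have hu : ∀ (y : Cycles x) l, u ((x.right ^ l) y.out) = U y l := fun y l => by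
    simp only [u]
    rw [hofpow]
    exact eq_of_modEq (hU y) (hmod y l)
  have hpσ : ∀ j, p (x.right j) = x'.right (p j) := fun j => by
    obtain ⟨y, l, rfl⟩ : ∃ y : Cycles x, ∃ l, (x.right ^ l) y.out = j := ⟨_, _, hk j⟩
    rw [← Equiv.Perm.mul_apply, ← pow_succ', hp, hp, pow_succ', Equiv.Perm.mul_apply]
  have huσ : ∀ j, u (x.right j) * x.left j = x'.left (p j) * u j := fun j => by
    obtain ⟨y, l, rfl⟩ : ∃ y : Cycles x, ∃ l, (x.right ^ l) y.out = j := ⟨_, _, hk j⟩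
    rw [← Equiv.Perm.mul_apply, ← pow_succ', hp, hu, hu]
    simp only [U, pathProd]
    group
  have hinj : Function.Injective p := by
    intro i j hij
    obtain ⟨y, l, rfl⟩ : ∃ y : Cycles x, ∃ l, (x.right ^ l) y.out = i := ⟨_, _, hk i⟩
    obtain ⟨y', l', rfl⟩ : ∃ y : Cycles x, ∃ l, (x.right ^ l) y.out = j := ⟨_, _, hk j⟩
    rw [hp, hp] at hij
    have h1 : Cycles.of x' (e y).out = Cycles.of x' (e y').out := by
      rw [Cycles.of_eq]
      rw [← Equiv.Perm.sameCycle_pow_left (n := l), hij, Equiv.Perm.sameCycle_pow_left]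
    rw [hof', hof', e.apply_eq_iff_eq] at h1
    subst h1
    rw [right_pow_eq_iff, hlen] at hij
    rw [right_pow_eq_iff]
    exact hij
  let q : Equiv.Perm (Fin n) := Equiv.ofBijective p (Finite.injective_iff_bijective.1 hinj)
  have hq : ∀ j, q j = p j := fun _ => rfl
  refine ⟨⟨fun a => u (x.right (q⁻¹ a)), q⟩, ?_⟩
  rw [mul_inv_eq_iff_eq_mul]
  refine SemidirectProduct.ext ?_ ?_
  · funext a
    obtain ⟨b, rfl⟩ := q.surjective a
    rw [mul_left_apply, mul_left_apply]
    have h1 : q⁻¹ (x'.right⁻¹ (q b)) = x.right⁻¹ b := by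
      rw [Equiv.Perm.inv_eq_iff_eq, Equiv.Perm.inv_eq_iff_eq, hq, hq, ← hpσ]
      simp
    simp only [h1]
    have h2 : q⁻¹ (q b) = b := by simp
    rw [h2]
    have h3 : x.right (x.right⁻¹ b) = b := by simp
    rw [h3, huσ, hq]
  · ext1 j
    exact hpσ j

/-- For fixed `n` the number of trivial points is `n` minus the size of the support, so the modified
type determines the type. -/
theorem exists_conj_of_modifiedType_eq [Finite Γ] {x x' : Wreath Γ n}
    (h : modifiedType x = modifiedType x') : ∃ z : Wreath Γ n, z * x * z⁻¹ = x' := by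
  apply exists_conj_of_typeOf_eq
  have h1 := (modifiedType_eq_iff x x').1 h
  have h2 : pointCount x 1 1 = pointCount x' 1 1 := by
    have h3 := card_supp_add_pointCount x
    have h4 := card_supp_add_pointCount x'
    rw [← supportSize_modifiedType] at h3 h4
    rw [h] at h3
    omega
  funext c
  refine Multiset.ext.2 fun k => Nat.eq_of_mul_eq_mul_left k.pos ?_
  rw [← pointCount_eq, ← pointCount_eq]
  by_cases hck : c = 1 ∧ k = 1
  · rw [hck.1, hck.2, h2]
  · exact h1 c k hck

/-! ### Transporting cycles -/

/-- Length and class of a cycle involve only the orbit of `i`, so agreement along that orbit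
suffices. This covers both products with disjoint supports and enlargements of the set of points. -/
theorem cycle_congr {m : ℕ} {x : Wreath Γ n} {y : Wreath Γ m} {e : Fin n → Fin m}
    (he : Function.Injective e) {i : Fin n}
    (hr : ∀ k : ℕ, y.right (e ((x.right ^ k) i)) = e (x.right ((x.right ^ k) i)))
    (hl : ∀ k : ℕ, y.left (e ((x.right ^ k) i)) = x.left ((x.right ^ k) i)) :
    cycleLen y (e i) = cycleLen x i ∧ cycleClass y (e i) = cycleClass x i := by
  have h1 : ∀ k : ℕ, (y.right ^ k) (e i) = e ((x.right ^ k) i) := by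
    intro k
    induction k with
    | zero => simp
    | succ k ih => rw [pow_succ', Equiv.Perm.mul_apply, ih, hr, pow_succ', Equiv.Perm.mul_apply]
  have h2 : ∀ k : ℕ, pathProd y (e i) k = pathProd x i k := by
    intro k
    induction k with
    | zero => rfl
    | succ k ih => rw [pathProd, pathProd, ih, h1, hl]
  have h3 : cycleLen y (e i) = cycleLen x i := by
    refine Subtype.ext ?_
    change Function.minimalPeriod _ _ = Function.minimalPeriod _ _
    refine (Function.minimalPeriod_eq_minimalPeriod_iff).2 fun k => ?_
    unfold Function.IsPeriodicPt Function.IsFixedPt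
    rw [← Equiv.Perm.coe_pow, ← Equiv.Perm.coe_pow, h1, he.eq_iff]
  refine ⟨h3, ?_⟩
  rw [cycleClass, cycleClass, h3, h2]

theorem right_mem_supp {x : Wreath Γ n} {i : Fin n} : x.right i ∈ supp x ↔ i ∈ supp x := by
  rw [← not_iff_not, notMem_supp, notMem_supp]
  have h : x.right (x.right i) = x.right i ↔ x.right i = i := x.right.injective.eq_iff
  rw [h]
  refine and_congr_right fun h' => ?_
  rw [h']

theorem right_inv_mem_supp {x : Wreath Γ n} {i : Fin n} : x.right⁻¹ i ∈ supp x ↔ i ∈ supp x := by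
  rw [← right_mem_supp]
  simp

theorem right_pow_mem_supp {x : Wreath Γ n} {i : Fin n} (h : i ∈ supp x) (k : ℕ) :
    (x.right ^ k) i ∈ supp x := by
  induction k with
  | zero => simpa
  | succ k ih => rwa [pow_succ', Equiv.Perm.mul_apply, right_mem_supp]

theorem right_inv_of_notMem {x : Wreath Γ n} {i : Fin n} (h : i ∉ supp x) : x.right⁻¹ i = i := by
  rw [Equiv.Perm.inv_eq_iff_eq, (notMem_supp.1 h).1]

theorem supp_mul_subset (x y : Wreath Γ n) : supp (x * y) ⊆ supp x ∪ supp y := by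
  intro i hi
  by_contra h
  rw [Finset.mem_union, not_or] at h
  refine mem_supp.1 hi ⟨?_, ?_⟩
  · rw [mul_right_apply, (notMem_supp.1 h.2).1, (notMem_supp.1 h.1).1]
  · rw [mul_left_apply, right_inv_of_notMem h.1, (notMem_supp.1 h.2).2, (notMem_supp.1 h.1).2,
      mul_one]

theorem modifiedType_mul_of_disjoint {x y : Wreath Γ n} (h : Disjoint (supp x) (supp y)) :
    modifiedType (x * y) = modifiedType x + modifiedType y := by
  classical
  have hx : ∀ i ∈ supp x, cycleLen (x * y) i = cycleLen x i ∧
      cycleClass (x * y) i = cycleClass x i := by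
    intro i hi
    refine cycle_congr (e := id) Function.injective_id (fun k => ?_) fun k => ?_
    · have := Finset.disjoint_left.1 h (right_pow_mem_supp hi k)
      rw [id, id, mul_right_apply, (notMem_supp.1 this).1]
    · have := Finset.disjoint_left.1 h (right_inv_mem_supp.2 (right_pow_mem_supp hi k))
      rw [id, mul_left_apply, (notMem_supp.1 this).2, mul_one]
  have hy : ∀ i ∈ supp y, cycleLen (x * y) i = cycleLen y i ∧
      cycleClass (x * y) i = cycleClass y i := by
    intro i hi
    refine cycle_congr (e := id) Function.injective_id (fun k => ?_) fun k => ?_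
    · have := Finset.disjoint_right.1 h (right_mem_supp.2 (right_pow_mem_supp hi k))
      rw [id, id, mul_right_apply, (notMem_supp.1 this).1]
    · have := Finset.disjoint_right.1 h (right_pow_mem_supp hi k)
      rw [id, mul_left_apply, right_inv_of_notMem this, (notMem_supp.1 this).2, one_mul]
  funext c
  refine Multiset.ext.2 fun k => Nat.eq_of_mul_eq_mul_left (unshift c k).pos ?_
  rw [Pi.add_apply, Multiset.count_add, mul_add, ← pointCount_unshift, ← pointCount_unshift,
    ← pointCount_unshift]
  have hne := unshift_ne c k
  generalize unshift c k = k at hne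
  have triv : ∀ (w : Wreath Γ n) (i), i ∉ supp w → ¬ (cycleClass w i = c ∧ cycleLen w i = k) := by
    rintro w i hi ⟨rfl, rfl⟩
    exact hne (notMem_supp_iff_cycle.1 hi)
  rw [pointCount, pointCount, pointCount, ← Finset.card_union_of_disjoint]
  · congr 1
    ext i
    simp only [Finset.mem_union, Finset.mem_filter, Finset.mem_univ, true_and]
    by_cases hi : i ∈ supp x
    · have := triv y i (Finset.disjoint_left.1 h hi)
      rw [(hx i hi).1, (hx i hi).2]
      tauto
    · have h1 := triv x i hi
      by_cases hi' : i ∈ supp y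
      · rw [(hy i hi').1, (hy i hi').2]
        tauto
      · have h2 := triv y i hi'
        have h3 := triv (x * y) i fun h' => by
          have := supp_mul_subset x y h'
          simp [hi, hi'] at this
        tauto
  · rw [Finset.disjoint_filter]
    intro i _ h1 h2
    by_cases hi : i ∈ supp x
    · exact triv y i (Finset.disjoint_left.1 h hi) h2
    · exact triv x i hi h1

end Conjugacy

/-! ### Elements of a given modified type -/

section Existence

variable {Γ : Type*} [Group Γ] {n : ℕ}

/-- Putting `γ` at one point of the cycle and 1 at the others makes the cycle-product, read from
that point, equal to `γ`. -/
theorem exists_cycle (s : Finset (Fin n)) (γ : Γ) :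
    ∃ x : Wreath Γ n, supp x ⊆ s ∧
      ∀ i ∈ s, (cycleLen x i : ℕ) = s.card ∧ cycleClass x i = ConjClasses.mk γ := by
  classical
  obtain ⟨σ, hσ, hs⟩ := s.exists_cycleOn
  rcases s.eq_empty_or_nonempty with rfl | ⟨i₀, hi₀⟩
  · exact ⟨1, fun i hi => absurd hi (notMem_supp.2 ⟨rfl, rfl⟩), by simp⟩
  let x : Wreath Γ n := ⟨Pi.mulSingle i₀ γ, σ⟩
  have hlen : ∀ i ∈ s, (cycleLen x i : ℕ) = s.card := by
    intro i hi
    refine Nat.dvd_antisymm ?_ ?_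
    · refine Function.IsPeriodicPt.minimalPeriod_dvd ?_
      unfold Function.IsPeriodicPt Function.IsFixedPt
      rw [← Equiv.Perm.coe_pow]
      exact (hσ.pow_apply_eq hi).2 dvd_rfl
    · exact (hσ.pow_apply_eq hi).1 (pow_cycleLen x i)
  refine ⟨x, fun i hi => ?_, fun i hi => ⟨hlen i hi, ?_⟩⟩
  · by_contra h
    refine mem_supp.1 hi ⟨?_, ?_⟩
    · have : i ∉ σ.support := fun h' => h (hs h')
      simpa using this
    · have : i ≠ i₀ := fun h' => h (h' ▸ hi₀)
      simp [x, this]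
  · have h1 : cycleClass x i = cycleClass x i₀ :=
      sameCycle_induction x _ (cycleClass_apply x) (hσ.2 hi hi₀)
    have h2 : ∀ k, k < s.card → pathProd x i₀ (k + 1) = γ := by
      intro k hk
      induction k with
      | zero =>
        change (Pi.mulSingle i₀ γ : Fin n → Γ) i₀ * 1 = γ
        simp
      | succ k ih =>
        rw [pathProd, ih (by omega)]
        have : (σ ^ (k + 1)) i₀ ≠ i₀ := fun h => by
          have := Nat.le_of_dvd (by omega) ((hσ.pow_apply_eq hi₀).1 h)
          omega
        simp [x, this]
    have hpos : 0 < s.card := Finset.card_pos.2 ⟨i₀, hi₀⟩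
    rw [h1, cycleClass, hlen i₀ hi₀]
    congr 1
    obtain ⟨k, hk⟩ : ∃ k, s.card = k + 1 := ⟨s.card - 1, by omega⟩
    rw [hk]
    exact h2 k (by omega)

open scoped Classical in
/-- The partition-valued function with a single part `k` at `c`. -/
def singlePart (c : ConjClasses Γ) (k : ℕ+) : PartFun Γ := Pi.single c {k}

theorem exists_modifiedType_eq_singlePart (s : Finset (Fin n)) (c : ConjClasses Γ) (k : ℕ+)
    (hs : s.card = unshift c k) :
    ∃ x : Wreath Γ n, supp x ⊆ s ∧ modifiedType x = singlePart c k := by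
  classical
  obtain ⟨γ, rfl⟩ := ConjClasses.exists_rep c
  obtain ⟨x, hx, hxs⟩ := exists_cycle s γ
  refine ⟨x, hx, ?_⟩
  funext d
  refine Multiset.ext.2 fun l => Nat.eq_of_mul_eq_mul_left (unshift d l).pos ?_
  rw [← pointCount_unshift, pointCount]
  have h1 : (Finset.univ.filter fun i => cycleClass x i = d ∧ cycleLen x i = unshift d l) =
      if d = ConjClasses.mk γ ∧ l = k then s else ∅ := by
    ext i
    simp only [Finset.mem_filter, Finset.mem_univ, true_and]
    by_cases hi : i ∈ s
    · have hlen : cycleLen x i = unshift (ConjClasses.mk γ) k :=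
        PNat.coe_injective ((hxs i hi).1.trans hs)
      rw [(hxs i hi).2, hlen]
      have : (ConjClasses.mk γ = d ∧ unshift (ConjClasses.mk γ) k = unshift d l) ↔
          (d = ConjClasses.mk γ ∧ l = k) := by
        constructor
        · rintro ⟨rfl, h⟩
          refine ⟨rfl, ?_⟩
          unfold unshift at h
          split_ifs at h with h'
          · exact (add_right_cancel h).symm
          · exact h.symm
        · rintro ⟨rfl, rfl⟩
          exact ⟨rfl, rfl⟩
      rw [this]
      split_ifs with h
      · simp [h, hi]
      · simp [h]
    · have h2 := notMem_supp_iff_cycle.1 fun h => hi (hx h)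
      have h3 : ¬ (cycleClass x i = d ∧ cycleLen x i = unshift d l) := by
        rintro ⟨h4, h5⟩
        exact unshift_ne d l ⟨h4.symm.trans h2.1, h5.symm.trans h2.2⟩
      split_ifs <;> simp [h3, hi]
  rw [h1, singlePart]
  by_cases hd : d = ConjClasses.mk γ
  · subst hd
    by_cases hl : l = k
    · subst hl
      simp [hs]
    · simp [hl]
  · simp [hd]

theorem supportSize_singlePart (c : ConjClasses Γ) (k : ℕ+) :
    (singlePart c k).supportSize = unshift c k := by
  classical
  have h1 : (singlePart c k).degree = k := by
    rw [PartFun.degree, finsum_eq_single _ c]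
    · simp [singlePart]
    · intro d hd
      simp [singlePart, hd]
  rw [PartFun.supportSize, h1, unshift]
  split_ifs with h
  · subst h
    simp [singlePart]
  · have : (1 : ConjClasses Γ) ≠ c := fun h' => h h'.symm
    simp [singlePart, this]

theorem modifiedType_one : modifiedType (1 : Wreath Γ n) = 0 := by
  classical
  funext c
  refine Multiset.ext.2 fun k => Nat.eq_of_mul_eq_mul_left (unshift c k).pos ?_
  rw [← pointCount_unshift, pointCount, Finset.filter_false_of_mem]
  · simp
  · rintro i - ⟨h1, h2⟩
    have h3 := notMem_supp_iff_cycle.1 (notMem_supp.2 (⟨rfl, rfl⟩ :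
      (1 : Wreath Γ n).right i = i ∧ (1 : Wreath Γ n).left i = 1))
    exact unshift_ne c k ⟨h1.symm.trans h3.1, h2.symm.trans h3.2⟩

variable [Finite Γ]

theorem degree_add (μ ν : PartFun Γ) : (μ + ν).degree = μ.degree + ν.degree := by
  have : Finite (ConjClasses Γ) := Quotient.finite _
  rw [PartFun.degree, PartFun.degree, PartFun.degree,
    ← finsum_add_distrib (Set.toFinite _) (Set.toFinite _)]
  simp

theorem supportSize_add (μ ν : PartFun Γ) :
    (μ + ν).supportSize = μ.supportSize + ν.supportSize := by
  simp only [PartFun.supportSize, degree_add, Pi.add_apply, Multiset.card_add]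
  omega

/-- Induction on the support size: one part is split off and realized by a single cycle on points
outside the support of an element for the rest. -/
theorem exists_modifiedType_eq (μ : PartFun Γ) (h : μ.supportSize ≤ n) :
    ∃ x : Wreath Γ n, modifiedType x = μ := by
  classical
  induction hN : μ.supportSize using Nat.strong_induction_on generalizing μ with
  | _ N ih =>
    by_cases hμ : μ = 0
    · exact ⟨1, by rw [modifiedType_one, hμ]⟩
    · obtain ⟨c, hc⟩ := Function.ne_iff.1 hμ
      obtain ⟨k, hk⟩ := Multiset.exists_mem_of_ne_zero hc
      obtain ⟨ν, rfl⟩ : ∃ ν, μ = ν + singlePart c k := by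
        refine ⟨Function.update μ c ((μ c).erase k), ?_⟩
        funext d
        by_cases hd : d = c
        · subst hd
          rw [Pi.add_apply, Function.update_self, singlePart, Pi.single_eq_same, add_comm,
            Multiset.singleton_add, Multiset.cons_erase hk]
        · simp [singlePart, hd]
      have h1 := supportSize_add ν (singlePart c k)
      rw [supportSize_singlePart] at h1
      have hpos := (unshift c k).pos
      obtain ⟨x, hx⟩ := ih ν.supportSize (by omega) ν (by omega) rfl
      have h2 := supportSize_modifiedType x
      rw [hx] at h2
      have h3 : (unshift c k : ℕ) ≤ ((supp x)ᶜ).card := by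
        rw [Finset.card_compl, Fintype.card_fin]
        omega
      obtain ⟨s, hs, hcard⟩ := Finset.exists_subset_card_eq h3
      obtain ⟨y, hy, hyt⟩ := exists_modifiedType_eq_singlePart s c k hcard
      refine ⟨x * y, ?_⟩
      rw [modifiedType_mul_of_disjoint, hx, hyt]
      rw [Finset.disjoint_right]
      exact fun i hi => Finset.mem_compl.1 (hs (hy hi))

/-- All these functions are realized in the single finite group $\Gamma_N$. This makes the rows of
the multiplication tables finitely supported. -/
theorem finite_supportSize_le (N : ℕ) : {μ : PartFun Γ | μ.supportSize ≤ N}.Finite :=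
  (Set.finite_range (modifiedType : Wreath Γ N → PartFun Γ)).subset
    fun μ hμ => exists_modifiedType_eq μ hμ

end Existence

/-! ### Enlarging the set of points -/

section Extend

variable {Γ : Type*} [Group Γ] {n m : ℕ} (e : Fin n ↪ Fin m)

/-- The element of `Γ_m` that acts as `x ∈ Γ_n` on the image of `e`, and trivially elsewhere. -/
def extend (x : Wreath Γ n) : Wreath Γ m :=
  ⟨Function.extend e x.left 1, x.right.viaEmbedding e⟩

@[simp] theorem extend_right_apply (x : Wreath Γ n) (i : Fin n) :
    (extend e x).right (e i) = e (x.right i) :=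
  Equiv.Perm.viaEmbedding_apply _ _ _

@[simp] theorem extend_left_apply (x : Wreath Γ n) (i : Fin n) :
    (extend e x).left (e i) = x.left i :=
  e.injective.extend_apply _ _ _

theorem extend_right_of_notMem (x : Wreath Γ n) {j : Fin m} (hj : j ∉ Set.range e) :
    (extend e x).right j = j :=
  Equiv.Perm.viaEmbedding_apply_of_notMem _ _ _ hj

theorem extend_left_of_notMem (x : Wreath Γ n) {j : Fin m} (hj : j ∉ Set.range e) :
    (extend e x).left j = 1 :=
  Function.extend_apply' _ _ _ hj

theorem extend_mul (x y : Wreath Γ n) : extend e (x * y) = extend e x * extend e y := by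
  have hr : (extend e (x * y)).right = (extend e x * extend e y).right := by
    ext1 j
    rw [mul_right_apply]
    by_cases hj : j ∈ Set.range e
    · obtain ⟨i, rfl⟩ := hj
      simp
    · rw [extend_right_of_notMem e _ hj, extend_right_of_notMem e _ hj,
        extend_right_of_notMem e _ hj]
  refine SemidirectProduct.ext ?_ hr
  funext j
  rw [mul_left_apply]
  by_cases hj : j ∈ Set.range e
  · obtain ⟨i, rfl⟩ := hj
    have : (extend e x).right⁻¹ (e i) = e (x.right⁻¹ i) := by
      rw [Equiv.Perm.inv_eq_iff_eq, extend_right_apply]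
      simp
    rw [this, extend_left_apply, extend_left_apply, extend_left_apply, mul_left_apply]
  · have : (extend e x).right⁻¹ j = j := by
      rw [Equiv.Perm.inv_eq_iff_eq, extend_right_of_notMem e _ hj]
    rw [this, extend_left_of_notMem e _ hj, extend_left_of_notMem e _ hj,
      extend_left_of_notMem e _ hj, mul_one]

theorem extend_injective : Function.Injective (extend (Γ := Γ) e) := by
  intro x y h
  refine SemidirectProduct.ext ?_ ?_
  · funext i
    rw [← extend_left_apply e x, h, extend_left_apply]
  · ext1 i
    apply e.injective
    rw [← extend_right_apply e x, h, extend_right_apply]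

theorem supp_extend (x : Wreath Γ n) : supp (extend e x) = (supp x).map e := by
  ext j
  by_cases hj : j ∈ Set.range e
  · obtain ⟨i, rfl⟩ := hj
    rw [Finset.mem_map' e, mem_supp, mem_supp, extend_right_apply, extend_left_apply,
      e.injective.eq_iff]
  · have h1 : j ∉ supp (extend e x) :=
      notMem_supp.2 ⟨extend_right_of_notMem e x hj, extend_left_of_notMem e x hj⟩
    have h2 : j ∉ (supp x).map e := fun h => by
      obtain ⟨i, -, rfl⟩ := Finset.mem_map.1 h
      exact hj ⟨i, rfl⟩
    tauto

theorem exists_extend_eq {y : Wreath Γ m} (h : ∀ j ∈ supp y, j ∈ Set.range e) :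
    ∃ x, extend e x = y := by
  have h1 : ∀ i, ∃ j, e j = y.right (e i) := by
    intro i
    by_cases hi : e i ∈ supp y
    · exact h _ (right_mem_supp.2 hi)
    · exact ⟨i, (notMem_supp.1 hi).1.symm⟩
  choose p hp using h1
  have hinj : Function.Injective p := by
    intro i j hij
    have := congrArg e hij
    rwa [hp, hp, y.right.injective.eq_iff, e.injective.eq_iff] at this
  let q : Equiv.Perm (Fin n) := Equiv.ofBijective p (Finite.injective_iff_bijective.1 hinj)
  refine ⟨⟨fun i => y.left (e i), q⟩, SemidirectProduct.ext ?_ ?_⟩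
  · funext j
    by_cases hj : j ∈ Set.range e
    · obtain ⟨i, rfl⟩ := hj
      rw [extend_left_apply]
    · rw [extend_left_of_notMem e _ hj, (notMem_supp.1 fun h' => hj (h j h')).2]
  · ext1 j
    by_cases hj : j ∈ Set.range e
    · obtain ⟨i, rfl⟩ := hj
      rw [extend_right_apply]
      exact hp i
    · rw [extend_right_of_notMem e _ hj, (notMem_supp.1 fun h' => hj (h j h')).1]

theorem modifiedType_extend (x : Wreath Γ n) : modifiedType (extend e x) = modifiedType x := by
  classical
  rw [modifiedType_eq_iff]
  intro c k hck
  rw [pointCount, pointCount, ← Finset.card_map e]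
  congr 1
  ext j
  simp only [Finset.mem_filter, Finset.mem_univ, true_and, Finset.mem_map]
  have h1 : ∀ i, cycleLen (extend e x) (e i) = cycleLen x i ∧
      cycleClass (extend e x) (e i) = cycleClass x i := fun i =>
    cycle_congr e.injective (fun _ => extend_right_apply e x _) fun _ => extend_left_apply e x _
  constructor
  · rintro ⟨rfl, rfl⟩
    by_cases hj : j ∈ Set.range e
    · obtain ⟨i, rfl⟩ := hj
      exact ⟨i, ⟨(h1 i).2.symm, (h1 i).1.symm⟩, rfl⟩
    · refine absurd (notMem_supp_iff_cycle.1 (notMem_supp.2 ?_)) hck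
      exact ⟨extend_right_of_notMem e x hj, extend_left_of_notMem e x hj⟩
  · rintro ⟨i, ⟨rfl, rfl⟩, rfl⟩
    exact ⟨(h1 i).2, (h1 i).1⟩

end Extend

/-! ### The degree is subadditive

The wreath product acts on the functions from `Fin n` to `Γ ∪ {0}`. An element with `b` cycles of
trivial cycle-product fixes `(|Γ| + 1) ^ b` of them. -/

section Degree

variable {Γ : Type*} [Group Γ] {n : ℕ}

/-- The functions `φ : Fin n → Γ ∪ {0}` that are fixed by `x = (g, σ)`. -/
def fixed (x : Wreath Γ n) : Set (Fin n → WithZero Γ) :=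
  {φ | ∀ i, φ (x.right i) = (x.left (x.right i) : WithZero Γ) * φ i}

theorem right_inv_right (x : Wreath Γ n) (i : Fin n) : x.right⁻¹ (x.right i) = i := by simp

theorem fixed_mul {x y : Wreath Γ n} {φ : Fin n → WithZero Γ} (hx : φ ∈ fixed x)
    (hy : φ ∈ fixed y) : φ ∈ fixed (x * y) := by
  intro i
  rw [mul_right_apply, mul_left_apply, hx, hy, right_inv_right, WithZero.coe_mul,
    mul_assoc]

theorem fixed_of_mul_left {x y : Wreath Γ n} {φ : Fin n → WithZero Γ} (hxy : φ ∈ fixed (x * y))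
    (hx : φ ∈ fixed x) : φ ∈ fixed y := by
  intro i
  have h1 := hxy i
  rw [mul_right_apply, mul_left_apply, hx, right_inv_right, WithZero.coe_mul,
    mul_assoc] at h1
  exact mul_left_cancel₀ WithZero.coe_ne_zero h1

theorem zero_mem_fixed (x : Wreath Γ n) : (0 : Fin n → WithZero Γ) ∈ fixed x := fun i => by simp

theorem single_mem_fixed [DecidableEq (Fin n)] {x : Wreath Γ n} {i : Fin n} :
    (Pi.single i 1 : Fin n → WithZero Γ) ∈ fixed x ↔ i ∉ supp x := by
  rw [notMem_supp]
  constructor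
  · intro h
    have h1 := h i
    rw [Pi.single_eq_same, mul_one] at h1
    have h2 : x.right i = i := by
      by_contra h'
      rw [Pi.single_eq_of_ne h'] at h1
      exact WithZero.coe_ne_zero h1.symm
    rw [h2, Pi.single_eq_same] at h1
    exact ⟨h2, by exact_mod_cast h1.symm⟩
  · rintro ⟨h1, h2⟩ j
    by_cases hj : j = i
    · subst hj
      simp [h1, h2]
    · have : x.right j ≠ i := fun h => hj (x.right.injective (h.trans h1.symm))
      simp [hj, this]

/-- The path starts at `x.right i` because the relation defining `fixed` uses the value of `x.left`
at the target point. -/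
theorem fixed_apply_pow {x : Wreath Γ n} {φ : Fin n → WithZero Γ} (hφ : φ ∈ fixed x) (i : Fin n)
    (k : ℕ) : φ ((x.right ^ k) i) = ((pathProd x (x.right i) k : Γ) : WithZero Γ) * φ i := by
  induction k with
  | zero => simp [pathProd]
  | succ k ih =>
    have : x.right ((x.right ^ k) i) = (x.right ^ k) (x.right i) := by
      rw [← Equiv.Perm.mul_apply, ← Equiv.Perm.mul_apply, ← pow_succ, ← pow_succ']
    rw [pow_succ', Equiv.Perm.mul_apply, hφ, ih, pathProd, WithZero.coe_mul, mul_assoc, this]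

theorem cycleClass_eq_one_iff {x : Wreath Γ n} {i : Fin n} :
    cycleClass x i = 1 ↔ pathProd x (x.right i) (cycleLen x i) = 1 := by
  rw [← cycleClass_apply, cycleClass, cycleLen_apply, ConjClasses.one_eq_mk_one,
    ConjClasses.mk_eq_mk_iff_isConj, isConj_comm, isConj_one_right]

theorem fixed_eq_of_sameCycle {x : Wreath Γ n} {φ ψ : Fin n → WithZero Γ} (hφ : φ ∈ fixed x)
    (hψ : ψ ∈ fixed x) {i j : Fin n} (hij : x.right.SameCycle i j) (h : φ i = ψ i) :
    φ j = ψ j := by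
  obtain ⟨k, rfl⟩ := hij.exists_nat_pow_eq
  rw [fixed_apply_pow hφ, fixed_apply_pow hψ, h]

theorem piecewise_mem_fixed {x : Wreath Γ n} {φ ψ : Fin n → WithZero Γ} (hφ : φ ∈ fixed x)
    (hψ : ψ ∈ fixed x) (p : Fin n) [DecidablePred fun k => x.right.SameCycle p k] :
    (fun k => if x.right.SameCycle p k then φ k else ψ k) ∈ fixed x := by
  intro i
  have : x.right.SameCycle p (x.right i) ↔ x.right.SameCycle p i :=
    Equiv.Perm.sameCycle_apply_right
  simp only [this]
  split_ifs
  · exact hφ i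
  · exact hψ i

/-- These elements play the role of reflections: the fixed functions form a "hyperplane". For `i =
j` the element is diagonal, otherwise it is a twisted transposition. -/
theorem exists_reflection (i j : Fin n) (a : Γ) :
    ∃ r : Wreath Γ n, fixed r = {φ | φ j = (a : WithZero Γ) * φ i} ∧
      (∀ k, k ∉ supp r ∨ k = i ∨ k = j) ∧ r.right i = j ∧ r.left j = a := by
  classical
  by_cases hij : i = j
  · subst hij
    refine ⟨⟨Pi.mulSingle i a, 1⟩, ?_, fun k => ?_, rfl, by simp⟩
    · ext φ
      constructor
      · intro h
        simpa using h i
      · intro h k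
        by_cases hk : k = i
        · subst hk
          simpa using h
        · simp [hk]
    · by_cases hk : k = i
      · exact Or.inr (Or.inl hk)
      · exact Or.inl (notMem_supp.2 (by simp [hk]))
  · have hji : j ≠ i := fun h => hij h.symm
    refine ⟨⟨fun k => if k = j then a else if k = i then a⁻¹ else 1, Equiv.swap i j⟩, ?_,
      fun k => ?_, by simp, by simp⟩
    · ext φ
      constructor
      · intro h
        simpa using h i
      · intro h k
        have h' : φ j = a * φ i := h
        by_cases hk : k = i
        · subst hk
          simpa using h
        · by_cases hk' : k = j
          · subst hk'
            simp [hij, h']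
          · simp [hk, hk', Equiv.swap_apply_of_ne_of_ne]
    · by_cases hk : k = i
      · exact Or.inr (Or.inl hk)
      · by_cases hk' : k = j
        · exact Or.inr (Or.inr hk')
        · exact Or.inl (notMem_supp.2 (by simp [hk, hk', Equiv.swap_apply_of_ne_of_ne]))

theorem update_mem_fixed [DecidableEq (Fin n)] {y : Wreath Γ n} {i : Fin n} (hi : i ∉ supp y)
    {φ : Fin n → WithZero Γ} (hφ : φ ∈ fixed y) (b : WithZero Γ) :
    Function.update φ i b ∈ fixed y := by
  obtain ⟨h1, h2⟩ := notMem_supp.1 hi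
  intro k
  by_cases hk : k = i
  · subst hk
    simp [h1, h2]
  · have : y.right k ≠ i := fun h => hk (y.right.injective (h.trans h1.symm))
    rw [Function.update_of_ne this, Function.update_of_ne hk]
    exact hφ k

/-- A fixed function is determined by its values at one point of each cycle. Such a value is
arbitrary if the cycle-product is trivial; otherwise going once round the cycle forces it to be 0.
-/
theorem ncard_fixed (x : Wreath Γ n) :
    (fixed x).ncard = Nat.card (WithZero Γ) ^ (balanced x).card := by
  classical
  have hof : ∀ y : Cycles x, Cycles.of x y.out = y := fun y => Quotient.out_eq y
  have hk : ∀ j : Fin n, ∃ k : ℕ, (x.right ^ k) (Cycles.of x j).out = j := fun j =>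
    (Cycles.of_eq.1 (hof (Cycles.of x j))).exists_nat_pow_eq
  choose k hk using hk
  have hofpow : ∀ (y : Cycles x) l, Cycles.of x ((x.right ^ l) y.out) = y := fun y l => by
    conv_rhs => rw [← hof y]
    exact Cycles.of_eq.2 (Equiv.Perm.SameCycle.symm ⟨l, by simp⟩)
  have hmod : ∀ (y : Cycles x) l, k ((x.right ^ l) y.out) ≡ l [MOD cycleLen x y.out] :=
    fun y l => by
      have := hk ((x.right ^ l) y.out)
      rw [hofpow] at this
      exact (right_pow_eq_iff _ _ _ _).1 this
  have hbal : ∀ y : Cycles x, y ∈ balanced x ↔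
      pathProd x (x.right y.out) (cycleLen x y.out) = 1 := fun y => by
    rw [mem_balanced, ← cycleClass_eq_one_iff, ← Cycles.prodClass_of, hof]
  let res : fixed x → ({y // y ∈ balanced x} → WithZero Γ) := fun φ y => φ.1 y.1.out
  have hres : Function.Bijective res := by
    constructor
    · intro φ ψ h
      refine Subtype.ext (funext fun j => ?_)
      refine fixed_eq_of_sameCycle φ.2 ψ.2 (i := (Cycles.of x j).out)
        (Cycles.of_eq.1 (hof _)) ?_
      by_cases hj : Cycles.of x j ∈ balanced x
      · exact congrFun h ⟨_, hj⟩
      · have hz : ∀ χ : fixed x, χ.1 (Cycles.of x j).out = 0 := fun χ => by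
          by_contra h0
          have := fixed_apply_pow χ.2 (Cycles.of x j).out (cycleLen x (Cycles.of x j).out)
          rw [pow_cycleLen, right_eq_mul₀ h0] at this
          exact hj ((hbal _).2 (by exact_mod_cast this))
        rw [hz, hz]
    · intro v
      let φ : Fin n → WithZero Γ := fun j =>
        if h : Cycles.of x j ∈ balanced x then
          ((pathProd x (x.right (Cycles.of x j).out) (k j) : Γ) : WithZero Γ) * v ⟨_, h⟩ else 0
      have hφ : ∀ (y : Cycles x) (l : ℕ), φ ((x.right ^ l) y.out) =
          if h : y ∈ balanced x then
            ((pathProd x (x.right y.out) l : Γ) : WithZero Γ) * v ⟨_, h⟩ else 0 := fun y l => by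
        simp only [φ]
        have h1 := hmod y l
        generalize k ((x.right ^ l) y.out) = a at h1
        rw [hofpow]
        split_ifs with h
        · congr 2
          refine eq_of_modEq (f := pathProd x (x.right y.out)) (fun a => ?_) h1
          have := pathProd_cycleLen_add x (x.right y.out) a
          rwa [cycleLen_apply, (hbal y).1 h, mul_one] at this
        · rfl
      have hmem : φ ∈ fixed x := fun j => by
        obtain ⟨y, l, rfl⟩ : ∃ y : Cycles x, ∃ l, (x.right ^ l) y.out = j := ⟨_, _, hk j⟩
        rw [← Equiv.Perm.mul_apply, ← pow_succ', hφ, hφ]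
        split_ifs with h
        · rw [pathProd, WithZero.coe_mul, mul_assoc, pow_succ, Equiv.Perm.mul_apply]
        · rw [mul_zero]
      refine ⟨⟨φ, hmem⟩, funext fun y => ?_⟩
      have := hφ y.1 0
      rw [dif_pos y.2] at this
      simpa [pathProd] using this
  rw [← Nat.card_coe_set_eq, Nat.card_congr (Equiv.ofBijective res hres), Nat.card_fun,
    Nat.card_eq_fintype_card (α := {y // y ∈ balanced x}), Fintype.card_coe]

variable [Finite Γ]

theorem finite_set_fun {Γ : Type*} [Finite Γ] {n : ℕ} (s : Set (Fin n → WithZero Γ)) : s.Finite :=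
  have : Finite (WithZero Γ) := inferInstanceAs (Finite (Option Γ))
  Set.toFinite s

theorem ncard_fixed_pos (x : Wreath Γ n) : 0 < (fixed x).ncard :=
  (Set.ncard_pos (finite_set_fun _)).2 ⟨0, zero_mem_fixed x⟩

/-- A set of fixed functions that contains, for each fixed function, one that coincides with it
outside of the cycle of `p`, is not too small. -/
theorem ncard_fixed_le {x : Wreath Γ n} (p : Fin n) (S : Set (Fin n → WithZero Γ))
    (f : (Fin n → WithZero Γ) → Fin n → WithZero Γ) (hf : ∀ φ ∈ fixed x, f φ ∈ S)
    (hfp : ∀ φ ∈ fixed x, ∀ k, ¬ x.right.SameCycle p k → f φ k = φ k) :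
    (fixed x).ncard ≤ Nat.card (WithZero Γ) * S.ncard := by
  have : Finite (WithZero Γ) := inferInstanceAs (Finite (Option Γ))
  rw [← Set.ncard_univ, ← Set.ncard_prod]
  refine Set.ncard_le_ncard_of_injOn (fun φ => (φ p, f φ)) (fun φ hφ => ⟨Set.mem_univ _, hf φ hφ⟩)
    (fun φ hφ ψ hψ h => ?_) (Set.toFinite _)
  rw [Prod.mk.injEq] at h
  funext k
  by_cases hk : x.right.SameCycle p k
  · exact fixed_eq_of_sameCycle hφ hψ hk h.1
  · rw [← hfp φ hφ k hk, ← hfp ψ hψ k hk, h.2]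

/-- A "hyperplane" cuts the number of fixed functions by a factor of at most $|\Gamma|+1$: each
fixed function can be modified on a single cycle so as to satisfy the equation. -/
theorem ncard_fixed_le_inter (x : Wreath Γ n) (i j : Fin n) (a : Γ) :
    (fixed x).ncard ≤
      Nat.card (WithZero Γ) * (fixed x ∩ {φ | φ j = (a : WithZero Γ) * φ i}).ncard := by
  classical
  by_cases hij : x.right.SameCycle j i
  · refine ncard_fixed_le j _ (fun φ k => if x.right.SameCycle j k then 0 else φ k)
      (fun φ hφ => ⟨piecewise_mem_fixed (zero_mem_fixed x) hφ j, ?_⟩)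
      fun φ _ k hk => if_neg hk
    simp [hij, Equiv.Perm.SameCycle.refl]
  by_cases h : ∃ ψ ∈ fixed x, ψ j ≠ 0
  · obtain ⟨ψ, hψ, h0⟩ := h
    -- On the cycle of `j` the function is replaced by a right multiple of `ψ` with the required
    -- value at `j`; right multiplication preserves fixedness because `x` acts from the left.
    refine ncard_fixed_le j _
      (fun φ k => if x.right.SameCycle j k then ψ k * ((ψ j)⁻¹ * ((a : WithZero Γ) * φ i)) else φ k)
      (fun φ hφ => ⟨piecewise_mem_fixed (φ := fun k => ψ k * ((ψ j)⁻¹ * ((a : WithZero Γ) * φ i)))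
        (fun k => ?_) hφ j, ?_⟩) fun φ _ k hk => if_neg hk
    · simp only [hψ k, mul_assoc]
    · simp [hij, Equiv.Perm.SameCycle.refl, mul_inv_cancel_left₀ h0]
  · push Not at h
    -- Every fixed function vanishes at `j`, so the equation is achieved by making it vanish on the
    -- cycle of `i`.
    refine ncard_fixed_le i _ (fun φ k => if x.right.SameCycle i k then 0 else φ k)
      (fun φ hφ => ⟨piecewise_mem_fixed (zero_mem_fixed x) hφ i, ?_⟩)
      fun φ _ k hk => if_neg hk
    have hij' : ¬ x.right.SameCycle i j := fun h' => hij h'.symm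
    simp [hij', Equiv.Perm.SameCycle.refl, h φ hφ]

/-- Splitting off a reflection from an element that is non-trivial at `i`. -/
theorem exists_eq_reflection_mul (y : Wreath Γ n) {i : Fin n} (hi : i ∈ supp y) :
    ∃ r y' : Wreath Γ n, y = r * y' ∧ (supp y').card < (supp y).card ∧
      Nat.card (WithZero Γ) * (fixed y).ncard ≤ (fixed y').ncard ∧
      ∀ x : Wreath Γ n, (fixed x).ncard ≤
        Nat.card (WithZero Γ) * (fixed x ∩ fixed r).ncard := by
  classical
  have : Finite (WithZero Γ) := inferInstanceAs (Finite (Option Γ))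
  -- The reflection agrees with `y` at `i`, so that $r^{-1}y$ becomes trivial there, while every
  -- function fixed by `y` satisfies the equation of `r`.
  obtain ⟨r, hr, hrs, hri, hrj⟩ := exists_reflection i (y.right i) (y.left (y.right i))
  obtain ⟨y', rfl⟩ : ∃ y', y = r * y' := ⟨r⁻¹ * y, by group⟩
  have hinv : r.right⁻¹ ((r * y').right i) = i := by
    rw [Equiv.Perm.inv_eq_iff_eq, hri]
  have hi' : i ∉ supp y' := by
    rw [notMem_supp]
    have h1 : y'.right i = i := r.right.injective (by rw [hri]; rfl)
    refine ⟨h1, ?_⟩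
    rw [mul_left_apply, hinv] at hrj
    exact left_eq_mul.1 hrj
  have hsub : supp y' ⊆ supp (r * y') := by
    intro k hk
    rcases hrs k with h | h | h
    · by_contra h'
      obtain ⟨h1, h2⟩ := notMem_supp.1 h'
      rw [mul_right_apply] at h1
      rw [mul_left_apply, (notMem_supp.1 h).2, one_mul, right_inv_of_notMem h] at h2
      exact mem_supp.1 hk ⟨r.right.injective (h1.trans (notMem_supp.1 h).1.symm), h2⟩
    · exact absurd (h ▸ hk) hi'
    · rw [h, right_mem_supp]
      exact hi
  refine ⟨r, y', rfl, Finset.card_lt_card ⟨hsub, fun h => hi' (h hi)⟩, ?_, fun x => ?_⟩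
  · have hφr : ∀ φ ∈ fixed (r * y'), φ ∈ fixed r := fun φ hφ => by
      rw [hr]
      exact hφ i
    -- Since `i` is in the support of `r * y'`, the value at `i` of a fixed function is either
    -- determined by the value at another point or forced to be 0. As `y'` leaves the value at `i`
    -- free, it fixes at least $|\Gamma|+1$ times as many functions.
    have hdet : ∀ φ ∈ fixed (r * y'), ∀ ψ ∈ fixed (r * y'), (∀ k, k ≠ i → φ k = ψ k) →
        φ = ψ := by
      intro φ hφ ψ hψ h
      funext k
      by_cases hk : k = i
      · subst hk
        by_cases hj : (r * y').right k = k
        · have hz : ∀ χ ∈ fixed (r * y'), χ k = 0 := fun χ hχ => by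
            by_contra h0
            have := hχ k
            rw [hj, right_eq_mul₀ h0] at this
            exact mem_supp.1 hi ⟨hj, by exact_mod_cast this⟩
          rw [hz φ hφ, hz ψ hψ]
        · have h1 := h _ hj
          rw [hφ k, hψ k] at h1
          exact mul_left_cancel₀ WithZero.coe_ne_zero h1
      · exact h k hk
    rw [← Set.ncard_univ, ← Set.ncard_prod]
    refine Set.ncard_le_ncard_of_injOn (fun p => Function.update p.2 i p.1)
      (fun p hp => update_mem_fixed hi' (fixed_of_mul_left hp.2 (hφr _ hp.2)) _)
      (fun p hp p' hp' h => ?_) (finite_set_fun _)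
    refine Prod.ext ?_ (hdet _ hp.2 _ hp'.2 fun k hk => ?_)
    · simpa using congrFun h i
    · simpa [hk] using congrFun h k
  · rw [hr]
    exact ncard_fixed_le_inter x _ _ _

/-- Induction on the support of `y`, writing `x * (r * y')` as `(x * r) * y'`: passing to `x * r`
loses a factor of at most $|\Gamma|+1$, and passing to `y'` gains at least that factor. The second
part is the inclusion of fixed sets when nothing is lost. -/
theorem ncard_fixed_mul_le (x y : Wreath Γ n) :
    (fixed x).ncard * (fixed y).ncard ≤ Nat.card (WithZero Γ) ^ n * (fixed (x * y)).ncard ∧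
      ((fixed x).ncard * (fixed y).ncard = Nat.card (WithZero Γ) ^ n * (fixed (x * y)).ncard →
        fixed (x * y) ⊆ fixed x) := by
  have : Finite (WithZero Γ) := inferInstanceAs (Finite (Option Γ))
  induction hN : (supp y).card using Nat.strong_induction_on generalizing x y with
  | _ N ih =>
    rcases (supp y).eq_empty_or_nonempty with h | ⟨i, hi⟩
    · have h1 : ∀ i, y.right i = i ∧ y.left i = 1 := fun i => notMem_supp.1 (by simp [h])
      have hy : y = 1 :=
        SemidirectProduct.ext (funext fun i => (h1 i).2) (Equiv.ext fun i => (h1 i).1)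
      subst hy
      have h2 : (fixed (1 : Wreath Γ n)) = Set.univ := Set.eq_univ_of_forall fun φ i => by simp
      rw [h2, Set.ncard_univ, Nat.card_fun, Nat.card_eq_fintype_card (α := Fin n),
        Fintype.card_fin, mul_one, mul_comm]
      exact ⟨le_rfl, fun _ => le_rfl⟩
    · obtain ⟨r, y', rfl, hcard, hy, hr⟩ := exists_eq_reflection_mul y hi
      obtain ⟨h1, h2⟩ := ih _ (hN ▸ hcard) (x * r) y' rfl
      rw [mul_assoc] at h1 h2
      have hsub : fixed x ∩ fixed r ⊆ fixed (x * r) := fun φ hφ => fixed_mul hφ.1 hφ.2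
      have hle := Set.ncard_le_ncard hsub (finite_set_fun _)
      have hx : (fixed x).ncard ≤ Nat.card (WithZero Γ) * (fixed (x * r)).ncard :=
        (hr x).trans (Nat.mul_le_mul_left _ hle)
      have h3 : (fixed x).ncard * (fixed (r * y')).ncard ≤
          (fixed (x * r)).ncard * (fixed y').ncard :=
        calc (fixed x).ncard * (fixed (r * y')).ncard
            ≤ Nat.card (WithZero Γ) * (fixed (x * r)).ncard * (fixed (r * y')).ncard :=
              Nat.mul_le_mul_right _ hx
          _ = (fixed (x * r)).ncard * (Nat.card (WithZero Γ) * (fixed (r * y')).ncard) := by ring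
          _ ≤ _ := Nat.mul_le_mul_left _ hy
      refine ⟨h3.trans h1, fun heq => ?_⟩
      have h4 := h2 (le_antisymm h1 (heq ▸ h3))
      -- Overall equality forces equality in each step, hence `fixed (x * r)` is no larger than
      -- `fixed x ∩ fixed r`, which it contains.
      have h5 : Nat.card (WithZero Γ) * (fixed (x * r)).ncard ≤ (fixed x).ncard := by
        refine Nat.le_of_mul_le_mul_right ?_ (ncard_fixed_pos (r * y'))
        calc Nat.card (WithZero Γ) * (fixed (x * r)).ncard * (fixed (r * y')).ncard
            = (fixed (x * r)).ncard * (Nat.card (WithZero Γ) * (fixed (r * y')).ncard) := by ring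
          _ ≤ (fixed (x * r)).ncard * (fixed y').ncard := Nat.mul_le_mul_left _ hy
          _ ≤ _ := h1.trans heq.ge
      have h6 : (fixed (x * r)).ncard ≤ (fixed x ∩ fixed r).ncard :=
        Nat.le_of_mul_le_mul_left (h5.trans (hr x)) Nat.card_pos
      have h7 := Set.eq_of_subset_of_ncard_le hsub h6 (finite_set_fun _)
      exact h4.trans (h7 ▸ Set.inter_subset_left)

theorem one_lt_card_withZero : 1 < Nat.card (WithZero Γ) := by
  have : Finite (WithZero Γ) := inferInstanceAs (Finite (Option Γ))
  exact Finite.one_lt_card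

theorem degree_mul_le (x y : Wreath Γ n) : (modifiedType (x * y)).degree ≤
    (modifiedType x).degree + (modifiedType y).degree := by
  have h := (ncard_fixed_mul_le x y).1
  rw [ncard_fixed, ncard_fixed, ncard_fixed, ← pow_add, ← pow_add,
    Nat.pow_le_pow_iff_right one_lt_card_withZero] at h
  have h1 := degree_modifiedType x
  have h2 := degree_modifiedType y
  have h3 := degree_modifiedType (x * y)
  omega

/-- The function that is 1 at `i` and 0 elsewhere detects whether `i` is in the support. By the case
of equality above, if `x * y` fixes it then so does `x`, and therefore `y`. -/
theorem supp_subset_of_degree_mul_eq {x y : Wreath Γ n} (h : (modifiedType (x * y)).degree =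
    (modifiedType x).degree + (modifiedType y).degree) :
    supp x ⊆ supp (x * y) ∧ supp y ⊆ supp (x * y) := by
  classical
  have h0 := (ncard_fixed_mul_le x y).2
  have h1 := degree_modifiedType x
  have h2 := degree_modifiedType y
  have h3 := degree_modifiedType (x * y)
  rw [ncard_fixed, ncard_fixed, ncard_fixed, ← pow_add, ← pow_add] at h0
  have h4 := h0 (congrArg _ (by omega))
  have key : ∀ i, i ∉ supp (x * y) → i ∉ supp x ∧ i ∉ supp y := fun i hi => by
    rw [← single_mem_fixed] at hi
    exact ⟨single_mem_fixed.1 (h4 hi), single_mem_fixed.1 (fixed_of_mul_left hi (h4 hi))⟩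
  exact ⟨fun i hi => by_contra fun h' => (key i h').1 hi,
    fun i hi => by_contra fun h' => (key i h').2 hi⟩

end Degree

/-! ### Counting factorizations -/

section Counting

variable {Γ : Type*} [Group Γ] {n : ℕ}

theorem supp_conj (w x : Wreath Γ n) :
    supp (w * x * w⁻¹) = (supp x).map w.right.toEmbedding := by
  ext j
  obtain ⟨i, rfl⟩ := w.right.surjective j
  have h : w.right i = w.right.toEmbedding i := rfl
  rw [h, Finset.mem_map', ← h, ← not_iff_not, notMem_supp_iff_cycle, notMem_supp_iff_cycle,
    cycleLen_conj, cycleClass_conj]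

theorem conj_eq_self_of_fixes {z : Wreath Γ n} {e : Equiv.Perm (Fin n)}
    (he : ∀ i ∈ supp z, e i = i) :
    (⟨1, e⟩ : Wreath Γ n) * z * (⟨1, e⟩ : Wreath Γ n)⁻¹ = z := by
  have he' : ∀ i, i ∉ supp z → e i ∉ supp z := fun i hi h => by
    have := e.injective (he _ h)
    rw [this] at h
    exact hi h
  rw [mul_inv_eq_iff_eq_mul]
  refine SemidirectProduct.ext ?_ ?_
  · funext j
    obtain ⟨i, rfl⟩ := e.surjective j
    rw [mul_left_apply, mul_left_apply]
    have h1 : e⁻¹ (e i) = i := by simp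
    change 1 * z.left (e⁻¹ (e i)) = z.left (e i) * 1
    rw [h1, one_mul, mul_one]
    by_cases hi : i ∈ supp z
    · rw [he i hi]
    · rw [(notMem_supp.1 hi).2, (notMem_supp.1 (he' i hi)).2]
  · ext1 i
    change e (z.right i) = z.right (e i)
    by_cases hi : i ∈ supp z
    · rw [he i hi, he _ (right_mem_supp.2 hi)]
    · rw [(notMem_supp.1 hi).1, (notMem_supp.1 (he' i hi)).1]

/-- Points of `s` are labelled by themselves, the others by membership in `U` (resp. `V`). The
fibers have equal sizes, and a bijection respecting labels is as required. -/
theorem exists_perm_map_eq {α : Type*} [Fintype α] [DecidableEq α] {s U V : Finset α}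
    (hU : s ⊆ U) (hV : s ⊆ V) (hcard : U.card = V.card) :
    ∃ e : Equiv.Perm α, (∀ i ∈ s, e i = i) ∧ U.map e.toEmbedding = V := by
  let lab : Finset α → α → α ⊕ Bool := fun W i =>
    if i ∈ s then Sum.inl i else Sum.inr (decide (i ∈ W))
  have hlab : ∀ (W : Finset α), s ⊆ W → ∀ b, (Finset.univ.filter fun i => lab W i = b) =
      Sum.elim (fun i => if i ∈ s then {i} else ∅) (fun t => if t then W \ s else Wᶜ) b := by
    intro W hW b
    ext i
    simp only [Finset.mem_filter, Finset.mem_univ, true_and, lab]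
    rcases b with j | t
    · by_cases hi : i ∈ s
      · by_cases hj : j ∈ s
        · simp [hi, hj]
        · have : i ≠ j := fun h => hj (h ▸ hi)
          simp [hi, hj, this]
      · by_cases hj : j ∈ s
        · have : i ≠ j := fun h => hi (h ▸ hj)
          simp [hi, hj, this]
        · simp [hi, hj]
    · by_cases hi : i ∈ s
      · have := hW hi
        cases t <;> simp [hi, this]
      · cases t <;> simp [hi]
  obtain ⟨e, he⟩ := exists_equiv_of_card_fiber (lab U) (lab V) (by
    intro b
    rw [hlab U hU, hlab V hV]
    rcases b with j | t
    · rfl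
    · cases t
      · simp [Finset.card_compl, hcard]
      · simp [Finset.card_sdiff_of_subset hU, Finset.card_sdiff_of_subset hV, hcard])
  have hs : ∀ i, i ∈ s → e i = i := by
    intro i hi
    have := he i
    simp only [lab, hi, if_true] at this
    split_ifs at this
    exact Sum.inl.inj this
  refine ⟨e, hs, ?_⟩
  refine Finset.eq_of_subset_of_card_le ?_ (by rw [Finset.card_map, hcard])
  intro j hj
  obtain ⟨i, hi, rfl⟩ := Finset.mem_map.1 hj
  change e i ∈ V
  by_cases his : i ∈ s
  · rw [hs i his]
    exact hV his
  · have := he i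
    simp only [lab, his, if_false, hi, decide_true] at this
    split_ifs at this
    simpa using this

variable [Finite Γ]

open scoped Classical in
/-- The pairs `(x, y)` of elements of modified types `l` and `m` such that `x * y = z`. -/
def factorizations (l m : PartFun Γ) (z : Wreath Γ n) : Finset (Wreath Γ n × Wreath Γ n) :=
  Finset.univ.filter fun p => modifiedType p.1 = l ∧ modifiedType p.2 = m ∧ p.1 * p.2 = z

theorem mem_factorizations {l m : PartFun Γ} {z : Wreath Γ n} {p : Wreath Γ n × Wreath Γ n} :
    p ∈ factorizations l m z ↔ modifiedType p.1 = l ∧ modifiedType p.2 = m ∧ p.1 * p.2 = z := by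
  simp [factorizations]

/-- The number of factorizations `z = x * y` with factors of modified types `l` and `m`
such that `x` and `y` are both trivial exactly outside of `U`. -/
def exactCount (l m : PartFun Γ) (z : Wreath Γ n) (U : Finset (Fin n)) : ℕ :=
  ((factorizations l m z).filter fun p => supp p.1 ∪ supp p.2 = U).card

theorem exactCount_conj (l m : PartFun Γ) (w z : Wreath Γ n) (U : Finset (Fin n)) :
    exactCount l m (w * z * w⁻¹) (U.map w.right.toEmbedding) = exactCount l m z U := by
  symm
  let c := MulAut.conj w
  refine Finset.card_equiv (Equiv.prodCongr c.toEquiv c.toEquiv) fun p => ?_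
  have hc : ∀ x, c x = w * x * w⁻¹ := fun x => rfl
  have h1 : c p.1 * c p.2 = w * z * w⁻¹ ↔ p.1 * p.2 = z := by
    rw [← map_mul, ← hc z, c.injective.eq_iff]
  have h2 : supp (c p.1) ∪ supp (c p.2) = U.map w.right.toEmbedding ↔
      supp p.1 ∪ supp p.2 = U := by
    rw [hc, hc, supp_conj, supp_conj, ← Finset.map_union, Finset.map_inj]
  have h3 : ∀ x, modifiedType (c x) = modifiedType x := fun x => modifiedType_conj w x
  simp only [Finset.mem_filter, mem_factorizations, Equiv.prodCongr_apply, Prod.map_fst,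
    Prod.map_snd, MulEquiv.toEquiv_eq_coe, MulEquiv.coe_toEquiv, h1, h2, h3]

/-- Factors whose supports lie in the image of `e` come from $\Gamma_n$. This is the source of the
independence of `n`. -/
theorem exactCount_extend {m : ℕ} (e : Fin n ↪ Fin m) (l l' : PartFun Γ) (z : Wreath Γ n)
    (U : Finset (Fin n)) :
    exactCount l l' (extend e z) (U.map e) = exactCount l l' z U := by
  symm
  refine Finset.card_bij (fun p _ => (extend e p.1, extend e p.2)) ?_ ?_ ?_
  · intro p hp
    simp only [Finset.mem_filter, mem_factorizations, modifiedType_extend, supp_extend,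
      ← extend_mul, ← Finset.map_union] at hp ⊢
    rw [hp.1.2.2, hp.2]
    exact ⟨⟨hp.1.1, hp.1.2.1, rfl⟩, rfl⟩
  · intro p _ q _ h
    rw [Prod.mk.injEq] at h
    exact Prod.ext (extend_injective e h.1) (extend_injective e h.2)
  · rintro ⟨x, y⟩ hp
    simp only [Finset.mem_filter, mem_factorizations] at hp
    have hrange : ∀ j ∈ supp x ∪ supp y, j ∈ Set.range e := fun j hj => by
      rw [hp.2] at hj
      obtain ⟨i, -, rfl⟩ := Finset.mem_map.1 hj
      exact ⟨i, rfl⟩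
    obtain ⟨x, rfl⟩ := exists_extend_eq e fun j hj => hrange j (Finset.mem_union_left _ hj)
    obtain ⟨y, rfl⟩ := exists_extend_eq e fun j hj => hrange j (Finset.mem_union_right _ hj)
    refine ⟨(x, y), ?_, rfl⟩
    simp only [Finset.mem_filter, mem_factorizations, modifiedType_extend, supp_extend,
      ← extend_mul, ← Finset.map_union, (extend_injective e).eq_iff, Finset.map_inj] at hp ⊢
    exact hp

/-- One conjugation carries `z` to `z'`; a second, by a permutation fixing the support of `z'`
pointwise and hence commuting with `z'`, carries the set to `U'`. -/
theorem exactCount_eq_of_modifiedType_eq (l m : PartFun Γ) {z z' : Wreath Γ n}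
    {U U' : Finset (Fin n)} (hz : modifiedType z = modifiedType z') (hU : supp z ⊆ U)
    (hU' : supp z' ⊆ U') (hcard : U.card = U'.card) :
    exactCount l m z U = exactCount l m z' U' := by
  obtain ⟨w, rfl⟩ := exists_conj_of_modifiedType_eq hz
  rw [← exactCount_conj l m w z U]
  obtain ⟨e, he, heU⟩ := exists_perm_map_eq (s := supp (w * z * w⁻¹))
    (U := U.map w.right.toEmbedding) (V := U') (by
      rw [supp_conj]
      exact Finset.map_subset_map.2 hU) hU' (by rw [Finset.card_map, hcard])
  rw [← exactCount_conj l m ⟨1, e⟩, conj_eq_self_of_fixes he, ← heU]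

theorem exactCount_eq (l m : PartFun Γ) {n' : ℕ} {z : Wreath Γ n} {z' : Wreath Γ n'}
    {U : Finset (Fin n)} {U' : Finset (Fin n')} (hz : modifiedType z = modifiedType z')
    (hU : supp z ⊆ U) (hU' : supp z' ⊆ U') (hcard : U.card = U'.card) :
    exactCount l m z U = exactCount l m z' U' := by
  wlog h : n ≤ n' generalizing n n'
  · exact (this hz.symm hU' hU hcard.symm (le_of_not_ge h)).symm
  rw [← exactCount_extend (Fin.castLEEmb h) l m z U]
  refine exactCount_eq_of_modifiedType_eq l m (by rw [modifiedType_extend, hz]) ?_ hU'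
    (by rw [Finset.card_map, hcard])
  rw [supp_extend]
  exact Finset.map_subset_map.2 hU

open scoped Classical in
/-- The common value of `exactCount l m z U` for all `z` of modified type `ν`, and all sets `U`
that consist of the support of `z` and `k` further points. -/
def structConst (l m ν : PartFun Γ) (k : ℕ) : ℕ :=
  if h : ∃ p : Σ n : ℕ, Wreath Γ n × Finset (Fin n), modifiedType p.2.1 = ν ∧
      supp p.2.1 ⊆ p.2.2 ∧ p.2.2.card = (supp p.2.1).card + k then
    exactCount l m h.choose.2.1 h.choose.2.2 else 0

theorem exactCount_eq_structConst (l m : PartFun Γ) {z : Wreath Γ n} {U : Finset (Fin n)} {k : ℕ}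
    (hU : supp z ⊆ U) (hk : U.card = (supp z).card + k) :
    exactCount l m z U = structConst l m (modifiedType z) k := by
  have h : ∃ p : Σ n : ℕ, Wreath Γ n × Finset (Fin n), modifiedType p.2.1 = modifiedType z ∧
      supp p.2.1 ⊆ p.2.2 ∧ p.2.2.card = (supp p.2.1).card + k := ⟨⟨n, z, U⟩, rfl, hU, hk⟩
  rw [structConst, dif_pos h]
  obtain ⟨h1, h2, h3⟩ := h.choose_spec
  refine exactCount_eq l m h1.symm hU h2 ?_
  rw [hk, h3, ← supportSize_modifiedType, ← supportSize_modifiedType, h1]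

theorem exists_of_structConst_ne_zero {l m ν : PartFun Γ} {k : ℕ} (h : structConst l m ν k ≠ 0) :
    ∃ (n : ℕ) (x y : Wreath Γ n), modifiedType x = l ∧ modifiedType y = m ∧
      modifiedType (x * y) = ν ∧ (supp x ∪ supp y).card = (supp (x * y)).card + k := by
  unfold structConst at h
  split_ifs at h with h'
  · obtain ⟨h1, h2, h3⟩ := h'.choose_spec
    generalize h'.choose = p at h h1 h2 h3
    obtain ⟨⟨x, y⟩, hp⟩ := Finset.card_pos.1 (Nat.pos_of_ne_zero h)
    simp only [Finset.mem_filter, mem_factorizations] at hp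
    refine ⟨p.1, x, y, hp.1.1, hp.1.2.1, ?_, ?_⟩
    · rw [hp.1.2.2, h1]
    · rw [hp.2, hp.1.2.2, h3]
  · exact absurd rfl h

/-- The first bound gives finiteness of the sums over `ν` and `k`. The last makes the top
coefficients constant: in the case of equality of degrees both factors live on the support of the
product. -/
theorem structConst_bounds {l m ν : PartFun Γ} {k : ℕ} (h : structConst l m ν k ≠ 0) :
    ν.supportSize + k ≤ l.supportSize + m.supportSize ∧ ν.degree ≤ l.degree + m.degree ∧
      (ν.degree = l.degree + m.degree → k = 0) := by
  obtain ⟨n, x, y, rfl, rfl, rfl, hk⟩ := exists_of_structConst_ne_zero h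
  refine ⟨?_, degree_mul_le x y, fun heq => ?_⟩
  · rw [supportSize_modifiedType, supportSize_modifiedType, supportSize_modifiedType, ← hk]
    exact Finset.card_union_le _ _
  · obtain ⟨h1, h2⟩ := supp_subset_of_degree_mul_eq heq
    have := Finset.card_le_card (Finset.union_subset h1 h2)
    omega

theorem card_factorizations (l m : PartFun Γ) (z : Wreath Γ n) :
    (factorizations l m z).card = ∑ k ∈ Finset.range (l.supportSize + m.supportSize + 1),
      (n - (modifiedType z).supportSize).choose k * structConst l m (modifiedType z) k := by
  classical
  set B := l.supportSize + m.supportSize with hB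
  -- `T` is the set of points where a factor is nontrivial but `z` is trivial.
  have h1 : (factorizations l m z).card =
      ∑ T ∈ (supp z)ᶜ.powerset, exactCount l m z (supp z ∪ T) := by
    rw [Finset.card_eq_sum_card_fiberwise (f := fun p => (supp p.1 ∪ supp p.2) \ supp z)
      (t := (supp z)ᶜ.powerset)]
    · refine Finset.sum_congr rfl fun T hT => ?_
      rw [exactCount]
      congr 1
      refine Finset.filter_congr fun p hp => ?_
      have hsub : supp z ⊆ supp p.1 ∪ supp p.2 :=
        (mem_factorizations.1 hp).2.2 ▸ supp_mul_subset p.1 p.2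
      have hd : Disjoint T (supp z) :=
        Finset.disjoint_left.2 fun i hi => Finset.mem_compl.1 (Finset.mem_powerset.1 hT hi)
      constructor
      · rintro rfl
        rw [Finset.union_sdiff_of_subset hsub]
      · intro h
        rw [h, Finset.union_sdiff_left, Finset.sdiff_eq_self_of_disjoint hd]
    · intro p _
      simp only [Finset.coe_powerset, Set.mem_preimage, Set.mem_powerset_iff, Finset.coe_subset]
      intro i hi
      exact Finset.mem_compl.2 (Finset.mem_sdiff.1 hi).2
  have h2 : ∀ T ∈ (supp z)ᶜ.powerset, exactCount l m z (supp z ∪ T) =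
      structConst l m (modifiedType z) T.card := by
    intro T hT
    refine exactCount_eq_structConst l m Finset.subset_union_left ?_
    refine Finset.card_union_of_disjoint (Finset.disjoint_right.2 fun i hi => ?_)
    exact Finset.mem_compl.1 (Finset.mem_powerset.1 hT hi)
  rw [h1, Finset.sum_congr rfl h2,
    Finset.sum_powerset_apply_card (structConst l m (modifiedType z)), Finset.card_compl,
    Fintype.card_fin, supportSize_modifiedType]
  simp only [smul_eq_mul]
  set N := n - (supp z).card
  -- The sum over `k` naturally ends at `N`, which depends on `n`. Terms beyond `N` vanish by the
  -- binomial coefficient and terms beyond `B` by the support bound, so the range can be made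
  -- independent of `n`.
  have h3 : ∀ k, k ∉ Finset.range (N + 1) →
      N.choose k * structConst l m (modifiedType z) k = 0 := fun k hk => by
    rw [Finset.mem_range, not_lt] at hk
    rw [Nat.choose_eq_zero_of_lt (by omega), zero_mul]
  have h4 : ∀ k, k ∉ Finset.range (B + 1) →
      N.choose k * structConst l m (modifiedType z) k = 0 := fun k hk => by
    rw [Finset.mem_range, not_lt] at hk
    by_contra h
    have := (structConst_bounds (right_ne_zero_of_mul h)).1
    omega
  rw [Finset.sum_subset (Finset.subset_union_left (s₂ := Finset.range (B + 1)))
      fun k _ hk => h3 k hk,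
    ← Finset.sum_subset (Finset.subset_union_right (s₁ := Finset.range (N + 1)))
      fun k _ hk => h4 k hk]

end Counting

/-! ### Integer-valued polynomials -/

section Polynomials

/-- Evaluation at an integer, as a ring homomorphism. -/
def intEvalHom (n : ℤ) : intValued →+* ℤ where
  toFun p := intEval p n
  map_zero' := by
    have := intEval_spec 0 n
    simpa using this.symm
  map_one' := by
    have := intEval_spec 1 n
    rw [OneMemClass.coe_one, Polynomial.eval_one] at this
    exact_mod_cast this.symm
  map_add' p q := by
    have := intEval_spec (p + q) n
    rw [Subring.coe_add, Polynomial.eval_add, intEval_spec, intEval_spec] at this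
    exact_mod_cast this.symm
  map_mul' p q := by
    have := intEval_spec (p * q) n
    rw [Subring.coe_mul, Polynomial.eval_mul, intEval_spec, intEval_spec] at this
    exact_mod_cast this.symm

theorem intEvalHom_apply (p : intValued) (n : ℤ) : intEvalHom n p = intEval p n := rfl

theorem intValued_eq_zero {p : intValued} {N : ℕ} (h : ∀ n : ℕ, N ≤ n → intEval p n = 0) :
    p = 0 := by
  refine Subtype.ext (Polynomial.eq_zero_of_infinite_isRoot _ ?_)
  refine ((Set.Ici_infinite N).image (f := fun n : ℕ => (n : ℚ))
    (Nat.cast_injective.injOn)).mono ?_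
  rintro _ ⟨n, hn, rfl⟩
  have h1 := intEval_spec p n
  rw [h n hn] at h1
  simpa [Polynomial.IsRoot] using h1

/-- `Ring.choose` gives integer values also at integers below `s`, as membership in $R$ demands. -/
theorem eval_binomial (s k : ℕ) (n : ℤ) :
    (Polynomial.C ((k.factorial : ℚ)⁻¹) *
      (descPochhammer ℚ k).comp (Polynomial.X - Polynomial.C (s : ℚ))).eval (n : ℚ) =
        (Ring.choose (n - s) k : ℤ) := by
  have h := Ring.descPochhammer_eq_factorial_smul_choose (n - s : ℤ) k
  rw [← Polynomial.eval_eq_smeval] at h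
  have h1 := descPochhammer_eval_cast (R := ℚ) k (n - s)
  rw [h] at h1
  have h2 : (k.factorial : ℚ) ≠ 0 := Nat.cast_ne_zero.2 k.factorial_ne_zero
  push_cast [nsmul_eq_mul] at h1
  rw [Polynomial.eval_mul, Polynomial.eval_C, Polynomial.eval_comp, Polynomial.eval_sub,
    Polynomial.eval_X, Polynomial.eval_C, ← h1, inv_mul_cancel_left₀ h2]

/-- The polynomial `binom(t - s, k)`. -/
def binomPoly (s k : ℕ) : intValued :=
  ⟨_, fun n => ⟨_, eval_binomial s k n⟩⟩

theorem intEval_binomPoly {s k n : ℕ} (h : s ≤ n) :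
    intEval (binomPoly s k) n = (n - s).choose k := by
  have h1 := intEval_spec (binomPoly s k) n
  have h2 := eval_binomial s k n
  have h3 : intEval (binomPoly s k) n = Ring.choose ((n : ℤ) - s) k := by
    exact_mod_cast h1.symm.trans h2
  rw [h3, ← Nat.cast_sub h, Ring.choose_natCast]

theorem binomPoly_zero (s : ℕ) : binomPoly s 0 = 1 := by
  refine Subtype.ext ?_
  simp [binomPoly]

end Polynomials

/-! ### Structure constants of the class algebras -/

section Structure

variable {Γ : Type*} [Group Γ] [Finite Γ] {n : ℕ}

/-- The polynomial whose value at `n` is the coefficient of `K_ν(n)` in `K_l(n) K_m(n)`. -/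
def structPoly (l m ν : PartFun Γ) : intValued :=
  ∑ k ∈ Finset.range (l.supportSize + m.supportSize + 1),
    (structConst l m ν k : intValued) * binomPoly ν.supportSize k

theorem structPoly_ne_zero {l m ν : PartFun Γ} (h : structPoly l m ν ≠ 0) :
    ν.supportSize ≤ l.supportSize + m.supportSize ∧ ν.degree ≤ l.degree + m.degree := by
  obtain ⟨k, -, hk⟩ := Finset.exists_ne_zero_of_sum_ne_zero h
  have : structConst l m ν k ≠ 0 := fun h0 => hk (by rw [h0, Nat.cast_zero, zero_mul])
  have := structConst_bounds this
  exact ⟨by omega, this.2.1⟩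

theorem structPoly_of_degree_eq {l m ν : PartFun Γ} (h : ν.degree = l.degree + m.degree) :
    structPoly l m ν = (structConst l m ν 0 : intValued) := by
  rw [structPoly, Finset.sum_eq_single 0]
  · rw [binomPoly_zero, mul_one]
  · intro k _ hk
    have : structConst l m ν k = 0 := by
      by_contra h'
      exact hk ((structConst_bounds h').2.2 h)
    rw [this, Nat.cast_zero, zero_mul]
  · simp

theorem card_factorizations_eq_intEval (l m : PartFun Γ) (z : Wreath Γ n) :
    ((factorizations l m z).card : ℤ) = intEval (structPoly l m (modifiedType z)) n := by
  -- Needed because the polynomial agrees with the truncated `(n - s).choose k` only from `s` on.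
  have hle : (modifiedType z).supportSize ≤ n := by
    rw [supportSize_modifiedType]
    exact (Finset.card_le_univ _).trans_eq (Fintype.card_fin n)
  rw [card_factorizations, structPoly, ← intEvalHom_apply, map_sum, Nat.cast_sum]
  refine Finset.sum_congr rfl fun k _ => ?_
  rw [map_mul, map_natCast, intEvalHom_apply, intEval_binomPoly hle, Nat.cast_mul, mul_comm]

/-- The table of the structure polynomials. -/
def polyTable (l m : PartFun Γ) : PartFun Γ →₀ intValued :=
  Finsupp.onFinset (finite_supportSize_le (l.supportSize + m.supportSize)).toFinset
    (structPoly l m) fun ν h => by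
      rw [Set.Finite.mem_toFinset]
      exact (structPoly_ne_zero h).1

theorem polyTable_apply (l m ν : PartFun Γ) : polyTable l m ν = structPoly l m ν := rfl

open scoped Classical in
/-- The table of the structure constants in top degree. -/
def topTable (l m : PartFun Γ) : PartFun Γ →₀ ℕ :=
  Finsupp.onFinset (finite_supportSize_le (l.supportSize + m.supportSize)).toFinset
    (fun ν => if ν.degree = l.degree + m.degree then structConst l m ν 0 else 0) fun ν h => by
      rw [Set.Finite.mem_toFinset]
      have h' : structConst l m ν 0 ≠ 0 := fun h0 => h (by simp [h0])
      exact (structConst_bounds h').1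

theorem topTable_ne_zero (l m ν : PartFun Γ) (h : topTable l m ν ≠ 0) :
    ν.degree = l.degree + m.degree := by
  by_contra h'
  exact h (if_neg h')

theorem polyTable_ne_zero (l m ν : PartFun Γ) (h : polyTable l m ν ≠ 0) :
    ν.degree ≤ l.degree + m.degree := (structPoly_ne_zero h).2

theorem polyTable_eq_topTable (l m ν : PartFun Γ) (h : ν.degree = l.degree + m.degree) :
    polyTable l m ν = (topTable l m ν : intValued) := by
  have h1 : topTable l m ν = structConst l m ν 0 := if_pos h
  rw [polyTable_apply, structPoly_of_degree_eq h, h1]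

theorem classSum_mul (l m : PartFun Γ) : classSum n l * classSum n m =
    ∑ z : Wreath Γ n, intEval (structPoly l m (modifiedType z)) n •
      MonoidAlgebra.of ℤ (Wreath Γ n) z := by
  classical
  unfold classSum
  rw [Finset.sum_mul_sum, ← Finset.sum_product',
    ← Finset.sum_fiberwise _ (fun p : Wreath Γ n × Wreath Γ n => p.1 * p.2)]
  refine Finset.sum_congr rfl fun z _ => ?_
  rw [← card_factorizations_eq_intEval, natCast_zsmul, ← Finset.sum_const]
  refine Finset.sum_congr ?_ fun p hp => ?_
  · ext p
    simp [mem_factorizations, and_assoc]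
  · rw [← map_mul, (mem_factorizations.1 hp).2.2]

theorem K_mul (n : ℕ) (l m : PartFun Γ) :
    K n l * K n m = (polyTable l m).sum fun ν p => intEval p n • K n ν := by
  classical
  refine Subtype.ext ?_
  change classSum n l * classSum n m = _
  rw [classSum_mul, Finsupp.sum, AddSubmonoidClass.coe_finsetSum]
  have h1 : ∀ ν, ((intEval (polyTable l m ν) n • K n ν : ClassAlgebra Γ n) :
      MonoidAlgebra ℤ (Wreath Γ n)) = ∑ z : Wreath Γ n, if modifiedType z = ν then
        intEval (structPoly l m ν) n • MonoidAlgebra.of ℤ (Wreath Γ n) z else 0 := by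
    intro ν
    rw [← Finset.sum_filter, ← Finset.smul_sum]
    rfl
  simp_rw [h1]
  rw [Finset.sum_comm]
  refine Finset.sum_congr rfl fun z _ => ?_
  rw [Finset.sum_ite_eq]
  split_ifs with h
  · rfl
  · have : structPoly l m (modifiedType z) = 0 := Finsupp.notMem_support_iff.1 h
    rw [this, ← intEvalHom_apply, map_zero, zero_smul]

theorem coeff_classSum (μ : PartFun Γ) (z : Wreath Γ n) [Decidable (modifiedType z = μ)] :
    (classSum n μ).coeff z = if modifiedType z = μ then 1 else 0 := by
  classical
  rw [classSum, MonoidAlgebra.coeff_sum, Finset.sum_apply']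
  simp [MonoidAlgebra.of_apply, Finsupp.single_apply]

theorem K_eq_zero (n : ℕ) (μ : PartFun Γ) (h : n < μ.supportSize) : K n μ = 0 := by
  classical
  refine Subtype.ext ?_
  change classSum n μ = 0
  rw [classSum, Finset.filter_false_of_mem, Finset.sum_empty]
  rintro x - rfl
  rw [supportSize_modifiedType] at h
  exact h.not_ge ((Finset.card_le_univ _).trans_eq (Fintype.card_fin n))

theorem K_zero (n : ℕ) : K n (0 : PartFun Γ) = 1 := by
  classical
  refine Subtype.ext ?_
  change classSum n 0 = 1
  have : (Finset.univ.filter fun x : Wreath Γ n => modifiedType x = 0) = {1} := by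
    ext x
    simp only [Finset.mem_filter, Finset.mem_univ, true_and, Finset.mem_singleton]
    constructor
    · intro h
      have h1 := supportSize_modifiedType x
      rw [h, supportSize_zero] at h1
      have h2 := Finset.card_eq_zero.1 h1.symm
      have h3 : ∀ i, x.right i = i ∧ x.left i = 1 := fun i => notMem_supp.1 (by simp [h2])
      exact SemidirectProduct.ext (funext fun i => (h3 i).2) (Equiv.ext fun i => (h3 i).1)
    · rintro rfl
      exact modifiedType_one
  rw [classSum, this, Finset.sum_singleton, map_one]

theorem sum_smul_K_eq_zero {n : ℕ} {s : Finset (PartFun Γ)} {g : PartFun Γ → ℤ}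
    (h : ∑ μ ∈ s, g μ • K n μ = 0) {μ : PartFun Γ} (hμ : μ ∈ s) (hn : μ.supportSize ≤ n) :
    g μ = 0 := by
  classical
  obtain ⟨z, rfl⟩ := exists_modifiedType_eq μ hn
  have h1 : ∑ μ ∈ s, g μ • classSum n μ = 0 := by
    have := congrArg (Subtype.val) h
    rwa [AddSubmonoidClass.coe_finsetSum] at this
  have h2 := congrArg (fun a => a.coeff z) h1
  simp only [MonoidAlgebra.coeff_sum, Finset.sum_apply', MonoidAlgebra.coeff_smul,
    Finsupp.smul_apply, coeff_classSum] at h2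
  simpa [hμ] using h2

theorem linearIndepOn_K (n : ℕ) :
    LinearIndepOn ℤ (K (Γ := Γ) n) {μ : PartFun Γ | μ.supportSize ≤ n} :=
  linearIndepOn_iff'.2 fun _ _ ht h _ hμ => sum_smul_K_eq_zero h hμ (ht hμ)

/-- A finite combination of the `K_ν`, with coefficients in `R`, that vanishes for all `n`, is
trivial. -/
theorem finsupp_eq_zero {g : PartFun Γ →₀ intValued}
    (h : ∀ n : ℕ, (g.sum fun ν p => intEval p n • K n ν) = 0) : g = 0 := by
  ext1 ν
  by_cases hν : ν ∈ g.support
  · exact intValued_eq_zero fun n hn => sum_smul_K_eq_zero (g := fun ν => intEval (g ν) n)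
      (h n) hν hn
  · exact Finsupp.notMem_support_iff.1 hν

theorem intEval_sum_sub (g g' : PartFun Γ →₀ intValued) (n : ℕ) :
    ((g - g').sum fun ν p => intEval p n • K n ν) =
      (g.sum fun ν p => intEval p n • K n ν) - g'.sum fun ν p => intEval p n • K n ν := by
  refine Finsupp.sum_sub_index fun ν p q => ?_
  rw [← intEvalHom_apply, map_sub, sub_smul]
  rfl

theorem finsupp_ext {g g' : PartFun Γ →₀ intValued}
    (h : ∀ n : ℕ, (g.sum fun ν p => intEval p n • K n ν) =
      g'.sum fun ν p => intEval p n • K n ν) : g = g' := by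
  refine sub_eq_zero.1 (finsupp_eq_zero fun n => ?_)
  rw [intEval_sum_sub, h, sub_self]

theorem polyTable_unique (f : PartFun Γ → PartFun Γ → PartFun Γ →₀ intValued) :
    (∀ (n : ℕ) (l m : PartFun Γ),
      K n l * K n m = (f l m).sum fun ν p => intEval p n • K n ν) ↔ f = polyTable := by
  constructor
  · intro h
    funext l m
    refine finsupp_ext fun n => ?_
    rw [← h, K_mul]
  · rintro rfl
    exact fun n => K_mul n

/-- Uniqueness of the polynomials turns $K_0(n)=1$, valid for all `n`, into an identity between rows
of the table. -/
theorem polyTable_zero (m : PartFun Γ) : polyTable 0 m = Finsupp.single m 1 := by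
  refine finsupp_ext fun n => ?_
  rw [← K_mul, K_zero, one_mul, Finsupp.sum_single_index, ← intEvalHom_apply, map_one, one_smul]
  rw [← intEvalHom_apply, map_zero, zero_smul]

theorem topTable_zero (m : PartFun Γ) : topTable 0 m = Finsupp.single m 1 := by
  classical
  ext ν
  by_cases h : ν.degree = (0 : PartFun Γ).degree + m.degree
  · have h1 := polyTable_eq_topTable 0 m ν h
    rw [polyTable_zero, Finsupp.single_apply] at h1
    rw [Finsupp.single_apply]
    have h2 : ((if m = ν then 1 else 0 : ℕ) : intValued) = (topTable 0 m ν : intValued) := by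
      rw [← h1]
      split_ifs <;> simp
    exact (Nat.cast_injective h2).symm
  · have h1 : topTable 0 m ν = 0 := by
      by_contra h'
      exact h (topTable_ne_zero _ _ _ h')
    have h2 : m ≠ ν := fun h' => h (by rw [h', degree_zero, zero_add])
    rw [h1, Finsupp.single_eq_of_ne' h2]

/-- The multiplication table of the class algebra of `Γ_n`. -/
def evalTable (n : ℕ) (l m : PartFun Γ) : PartFun Γ →₀ ℤ :=
  (polyTable l m).mapRange (intEvalHom n) (map_zero _)

theorem hasMulTable_K (n : ℕ) : HasMulTable (K (Γ := Γ) n) (evalTable n) := by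
  intro l m
  have h : (evalTable n l m).sum (fun ν r => r • K n ν) =
      (polyTable l m).sum fun ν p => intEvalHom n p • K n ν :=
    Finsupp.sum_mapRange_index (h := fun ν (r : ℤ) => r • K n ν) fun ν => zero_smul ℤ (K n ν)
  exact (K_mul n l m).trans h.symm

theorem evalTable_ne_zero (n : ℕ) (l m ν : PartFun Γ) (h : evalTable n l m ν ≠ 0) :
    ν.degree ≤ l.degree + m.degree := by
  refine polyTable_ne_zero l m ν fun h0 => h ?_
  rw [evalTable, Finsupp.mapRange_apply, h0, map_zero]

theorem evalTable_eq_topTable (n : ℕ) (l m ν : PartFun Γ) (h : ν.degree = l.degree + m.degree) :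
    evalTable n l m ν = (topTable l m ν : ℤ) := by
  rw [evalTable, Finsupp.mapRange_apply, polyTable_eq_topTable l m ν h, map_natCast]

theorem isRingFiltration_K (n : ℕ) :
    IsRingFiltration (degFil ℤ (K (Γ := Γ) n)) (filLT (degFil ℤ (K n))) :=
  isRingFiltration_degFil (hasMulTable_K n) (K_zero n) (evalTable_ne_zero n)

end Structure

/-! ### Rings with a given multiplication table -/

section Rings

variable {Γ : Type*} [Group Γ] {S A A' : Type*} [CommRing S] [CommRing A] [Algebra S A]
  [CommRing A'] [Algebra S A']

theorem exists_subalgebra_basis {b : PartFun Γ → A} (hli : LinearIndependent S b)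
    (hone : b 0 = 1) (hmul : ∀ l m, b l * b m ∈ Submodule.span S (Set.range b)) :
    ∃ (B : Subalgebra S A) (L : Module.Basis (PartFun Γ) S B), ∀ μ, (L μ : A) = b μ := by
  have hmul' : Submodule.span S (Set.range b) * Submodule.span S (Set.range b) ≤
      Submodule.span S (Set.range b) := by
    rw [Submodule.span_mul_span, Submodule.span_le]
    rintro _ ⟨_, ⟨l, rfl⟩, _, ⟨m, rfl⟩, rfl⟩
    exact hmul l m
  let B : Subalgebra S A := (Submodule.span S (Set.range b)).toSubalgebra
    (hone ▸ Submodule.subset_span ⟨0, rfl⟩) fun x y hx hy => hmul' (Submodule.mul_mem_mul hx hy)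
  refine ⟨B, (Module.Basis.span hli : Module.Basis (PartFun Γ) S
    (Submodule.span S (Set.range b))), fun μ => ?_⟩
  exact congrArg Subtype.val (Module.Basis.span_apply hli μ)

theorem exists_ring_of_table {b : PartFun Γ → A} {c : PartFun Γ → PartFun Γ → PartFun Γ →₀ S}
    (hb : HasMulTable b c) (hone : b 0 = 1)
    (hli : ∀ g : PartFun Γ →₀ S, (g.sum fun ν p => p • b ν) = 0 → g = 0) :
    ∃ (B : Subalgebra S A) (L : Module.Basis (PartFun Γ) S B), HasMulTable L c := by
  have hli' : LinearIndependent S b := linearIndependent_iff.2 fun g hg =>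
    hli g (by rwa [Finsupp.linearCombination_apply] at hg)
  obtain ⟨B, L, hL⟩ := exists_subalgebra_basis hli' hone fun l m => by
    rw [hb l m]
    exact Submodule.sum_mem _ fun ν _ => Submodule.smul_mem _ _ (Submodule.subset_span ⟨ν, rfl⟩)
  refine ⟨B, L, fun l m => Subtype.ext ?_⟩
  rw [Subalgebra.coe_mul, hL, hL, hb l m, Finsupp.sum, Finsupp.sum,
    AddSubmonoidClass.coe_finsetSum]
  refine Finset.sum_congr rfl fun ν _ => ?_
  rw [Subalgebra.coe_smul, hL]

/-- A ring with a prescribed table comes with no information about its unit; it is recovered by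
evaluating the identity map, multiplication by `L 0`, at 1. -/
theorem basis_zero_eq_one (L : Module.Basis (PartFun Γ) S A) (h : ∀ m, L 0 * L m = L m) :
    L 0 = 1 := by
  have h1 : LinearMap.mulLeft S (L 0) = LinearMap.id := L.ext fun m => h m
  have h2 := congrArg (fun g => g 1) h1
  simpa using h2

/-- The entries lie in a separate type `T`, since tables over `ℕ` are compared in algebras over $R$;
`hsmul` says that linear maps respect them. -/
theorem exists_algEquiv_of_table {T : Type*} [Zero T] [SMul T A] [SMul T A']
    (L : Module.Basis (PartFun Γ) S A) (L' : Module.Basis (PartFun Γ) S A')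
    {c : PartFun Γ → PartFun Γ → PartFun Γ →₀ T} (hL : HasMulTable L c) (hL' : HasMulTable L' c)
    (hone : L 0 = 1) (hone' : L' 0 = 1)
    (hsmul : ∀ (g : A →ₗ[S] A') (t : T) x, g (t • x) = t • g x) :
    ∃ e : A ≃ₐ[S] A', ∀ μ, e (L μ) = L' μ := by
  let e : A ≃ₗ[S] A' := L.equiv L' (Equiv.refl _)
  have he : ∀ μ, e (L μ) = L' μ := fun μ => by simp [e]
  have hmul : (LinearMap.mul S A).compr₂ e.toLinearMap =
      (LinearMap.mul S A').compl₁₂ e.toLinearMap e.toLinearMap := by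
    refine L.ext fun l => L.ext fun m => ?_
    simp only [LinearMap.compr₂_apply, LinearMap.compl₁₂_apply, LinearMap.mul_apply',
      LinearEquiv.coe_coe, he]
    rw [hL l m, hL' l m, Finsupp.sum, Finsupp.sum, map_sum]
    refine Finset.sum_congr rfl fun ν _ => ?_
    rw [← he ν]
    exact hsmul e.toLinearMap _ _
  refine ⟨AlgEquiv.ofLinearEquiv e ?_ fun x y => ?_, he⟩
  · rw [← hone, he, hone']
  · exact LinearMap.congr_fun (LinearMap.congr_fun hmul x) y

/-- The classes of the members of a basis form a basis of the associated graded ring. -/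
def grBasisOfBasis (L : Module.Basis (PartFun Γ) S A) :
    Module.Basis (PartFun Γ) S (AssocGr (degFil S L)) :=
  (grBasis L (fun _ => True) (fun _ h => absurd trivial h)
    (L.linearIndependent.comp _ Subtype.val_injective)).reindex
      (Equiv.subtypeUnivEquiv fun _ => trivial)

theorem grBasisOfBasis_apply (L : Module.Basis (PartFun Γ) S A) (μ : PartFun Γ) :
    grBasisOfBasis L μ = grClass S L μ := by
  rw [grBasisOfBasis, Module.Basis.reindex_apply, grBasis_apply]
  rfl

end Rings

/-! ### The rings $\mathcal F_\Gamma$ and $\mathcal G_\Gamma$ inside products over all $n$ -/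

section Limit

variable (Γ : Type u) [Group Γ]

/-- The product of the class algebras of all `Γ_n`. -/
def ProdClassAlgebra : Type u := ∀ n : ℕ, ClassAlgebra Γ n

instance : CommRing (ProdClassAlgebra Γ) := inferInstanceAs (CommRing (∀ n : ℕ, ClassAlgebra Γ n))

/-- Evaluation at `n` in the `n`-th factor. -/
instance : Algebra intValued (ProdClassAlgebra Γ) := RingHom.toAlgebra (show _ →+* _ from
  RingHom.pi fun n : ℕ => (algebraMap ℤ (ClassAlgebra Γ n)).comp (intEvalHom n))

/-- The projection to the `n`-th factor. -/
def ProdClassAlgebra.proj (n : ℕ) : ProdClassAlgebra Γ →+* ClassAlgebra Γ n :=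
  Pi.evalRingHom (fun n : ℕ => ClassAlgebra Γ n) n

theorem ProdClassAlgebra.ext {x y : ProdClassAlgebra Γ} (h : ∀ n, proj Γ n x = proj Γ n y) :
    x = y := funext h

theorem ProdClassAlgebra.proj_smul (n : ℕ) (p : intValued) (x : ProdClassAlgebra Γ) :
    proj Γ n (p • x) = intEval p n • proj Γ n x := by
  rw [Algebra.smul_def, map_mul, Algebra.smul_def]
  rfl

variable [Finite Γ]

/-- The family `(K_μ(n))_n`. -/
def ProdClassAlgebra.K (μ : PartFun Γ) : ProdClassAlgebra Γ := fun n => FarahatHigman.K n μ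

theorem ProdClassAlgebra.proj_sum (n : ℕ) (g : PartFun Γ →₀ intValued) :
    proj Γ n (g.sum fun ν p => p • K Γ ν) =
      g.sum fun ν p => intEval p n • FarahatHigman.K n ν := by
  rw [Finsupp.sum, map_sum]
  exact Finset.sum_congr rfl fun ν _ => proj_smul Γ n _ _

/-- The families $(K_\mu(n))_n$ multiply by the table in every factor, and they are independent over
$R$ by the uniqueness argument. Ring axioms are inherited from the product. -/
theorem exists_polyTable_ring : ∃ (F : Type u) (_ : CommRing F) (_ : Algebra intValued F)
    (L : Module.Basis (PartFun Γ) intValued F), HasMulTable L polyTable := by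
  have hb : HasMulTable (ProdClassAlgebra.K Γ) polyTable := fun l m =>
    ProdClassAlgebra.ext Γ fun n => by
      rw [ProdClassAlgebra.proj_sum, map_mul]
      exact K_mul n l m
  obtain ⟨B, L, hL⟩ := exists_ring_of_table hb (ProdClassAlgebra.ext Γ K_zero) fun g hg =>
    finsupp_eq_zero fun n => by
      rw [← ProdClassAlgebra.proj_sum, hg, map_zero]
  exact ⟨B, inferInstance, inferInstance, L, hL⟩

theorem hasMulTable_grClass_K (n : ℕ)
    [IsRingFiltration (degFil ℤ (K (Γ := Γ) n)) (filLT (degFil ℤ (K n)))] :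
    HasMulTable (grClass ℤ (K (Γ := Γ) n)) topTable :=
  hasMulTable_grClass (hasMulTable_K n) (evalTable_ne_zero n) topTable_ne_zero
    (evalTable_eq_topTable n)

theorem exists_grBasis_K (n : ℕ) : ∃ B : Module.Basis {μ : PartFun Γ // μ.supportSize ≤ n} ℤ
    (AssocGr (degFil ℤ (K (Γ := Γ) n))), ∀ μ, B μ = grClass ℤ (K n) (μ : PartFun Γ) :=
  ⟨grBasis (K n) (fun μ => μ.supportSize ≤ n) (fun μ h => K_eq_zero n μ (not_le.1 h))
    (linearIndepOn_K n), fun μ => grBasis_apply _ _ _ _ μ⟩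

theorem exists_topTable_ring : ∃ (G : Type u) (_ : CommRing G)
    (L : Module.Basis (PartFun Γ) ℤ G), HasMulTable L topTable := by
  have := isRingFiltration_K (Γ := Γ)
  let b : PartFun Γ → ∀ n : ℕ, AssocGr (degFil ℤ (K (Γ := Γ) n)) := fun μ n => grClass ℤ (K n) μ
  have hli : LinearIndependent ℤ b := by
    rw [linearIndependent_iff']
    intro s g hg μ hμ
    -- For this `n` all classes occurring in the relation belong to the basis of $\mathcal
    -- G_\Gamma(n)$.
    let n := s.sup PartFun.supportSize
    have hn : ∀ ν ∈ s, ν.supportSize ≤ n := fun ν hν => Finset.le_sup hν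
    obtain ⟨B, hB⟩ := exists_grBasis_K Γ n
    have h1 : ∑ ν ∈ s, g ν • grClass ℤ (K (Γ := Γ) n) ν = 0 := by
      have := congrFun hg n
      rw [Finset.sum_apply] at this
      exact this
    have h2 : LinearIndepOn ℤ (grClass ℤ (K (Γ := Γ) n)) {ν | ν.supportSize ≤ n} := by
      have := B.linearIndependent
      rw [funext hB] at this
      exact this
    exact linearIndepOn_iff'.1 h2 s g hn h1 μ hμ
  have hb : HasMulTable b topTable := by
    intro l m
    funext n
    rw [Finsupp.sum, Finset.sum_apply]
    exact hasMulTable_grClass_K Γ n l m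
  obtain ⟨B, L, hL⟩ := exists_subalgebra_basis hli
      (funext fun n => grClass_zero_eq_one (K_zero n)) fun l m => by
    rw [hb l m]
    exact Submodule.sum_mem _ fun ν _ => Submodule.smul_of_tower_mem _ _
      (Submodule.subset_span ⟨ν, rfl⟩)
  refine ⟨B, inferInstance, L, fun l m => Subtype.ext ?_⟩
  rw [Subalgebra.coe_mul, hL, hL, hb l m, Finsupp.sum, Finsupp.sum,
    AddSubmonoidClass.coe_finsetSum]
  refine Finset.sum_congr rfl fun ν _ => ?_
  rw [← hL]
  rfl

end Limit

/-! ### The graded ring of $\mathcal F_\Gamma$ as an extension of scalars -/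

section Extension

variable {Γ : Type*} [Group Γ] [Finite Γ] {F : Type*} [CommRing F] [Algebra intValued F]

theorem polyTable_basis_zero {L : Module.Basis (PartFun Γ) intValued F}
    (hL : HasMulTable L polyTable) : L 0 = 1 :=
  basis_zero_eq_one L fun m => by
    rw [hL, polyTable_zero, Finsupp.sum_single_index (by rw [zero_smul]), one_smul]

/-- Both sides have $R$-bases multiplying by `topTable`: the graded ring since lower terms drop out,
the tensor product by base change. -/
theorem exists_algEquiv_baseChange (LF : Module.Basis (PartFun Γ) intValued F)
    (hF : HasMulTable LF polyTable)
    [IsRingFiltration (degFil intValued LF) (filLT (degFil intValued LF))]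
    {G : Type*} [CommRing G] (LG : Module.Basis (PartFun Γ) ℤ G) (hG : HasMulTable LG topTable) :
    ∃ e : AssocGr (degFil intValued LF) ≃ₐ[intValued] intValued ⊗[ℤ] G,
      ∀ μ, e (grClass intValued LF μ) = 1 ⊗ₜ[ℤ] LG μ := by
  have hG1 : LG 0 = 1 := basis_zero_eq_one LG fun m => by
    rw [hG, topTable_zero, Finsupp.sum_single_index (by rw [zero_smul]), one_smul]
  have hgr := hasMulTable_grClass hF polyTable_ne_zero topTable_ne_zero polyTable_eq_topTable
  have hbc : ∀ μ, LG.baseChange intValued μ = 1 ⊗ₜ[ℤ] LG μ := fun μ =>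
    Module.Basis.baseChange_apply _ _ _
  obtain ⟨e, he⟩ := exists_algEquiv_of_table (grBasisOfBasis LF) (LG.baseChange intValued)
    (c := topTable) (fun l m => by
      simp only [grBasisOfBasis_apply]
      exact hgr l m) (fun l m => by
      simp only [hbc]
      rw [Algebra.TensorProduct.tmul_mul_tmul, mul_one, hG l m, Finsupp.sum, Finsupp.sum,
        TensorProduct.tmul_sum]
      refine Finset.sum_congr rfl fun ν _ => ?_
      rw [TensorProduct.tmul_smul])
    (by rw [grBasisOfBasis_apply, grClass_zero_eq_one (polyTable_basis_zero hF)])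
    (by rw [hbc, hG1, Algebra.TensorProduct.one_def])
    (fun g t x => map_nsmul g t x)
  exact ⟨e, fun μ => by rw [← grBasisOfBasis_apply, he, hbc]⟩

end Extension

end FarahatHigman

end

theorem mainTheorem2 (Γ : Type u) [Group Γ] [Finite Γ] :
    -- the degree defines a ring filtration on each class algebra
    ∃ _ : ∀ n : ℕ, IsRingFiltration (degFil ℤ (K (Γ := Γ) n)) (filLT (degFil ℤ (K n))),
    -- structure constants: non-negative integers, independent of `n`
    ∃ a : PartFun Γ → PartFun Γ → PartFun Γ →₀ ℕ,
      (∀ l m ν, a l m ν ≠ 0 → ν.degree = l.degree + m.degree) ∧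
      (∀ n : ℕ,
        (∃ B : Module.Basis {μ : PartFun Γ // μ.supportSize ≤ n} ℤ
            (AssocGr (degFil ℤ (K (Γ := Γ) n))),
          ∀ μ, B μ = grClass ℤ (K n) μ) ∧
        (∀ μ : PartFun Γ, n < μ.supportSize → K n μ = 0) ∧
        HasMulTable (grClass ℤ (K (Γ := Γ) n)) a) ∧
      -- the polynomials `f` that interpolate the structure constants of the class algebras
      ∃ f : PartFun Γ → PartFun Γ → PartFun Γ →₀ intValued,
        (∀ f' : PartFun Γ → PartFun Γ → PartFun Γ →₀ intValued,
          (∀ (n : ℕ) (l m : PartFun Γ),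
            K n l * K n m = (f' l m).sum fun ν p => intEval p n • K n ν) ↔ f' = f) ∧
        (∀ l m ν, l.degree + m.degree < ν.degree → f l m ν = 0) ∧
        (∀ l m ν, ν.degree = l.degree + m.degree → f l m ν = (a l m ν : intValued)) ∧
        -- the rings with these structure constants exist
        (∃ (G : Type u) (_ : CommRing G) (L : Module.Basis (PartFun Γ) ℤ G), HasMulTable L a) ∧
        (∃ (F : Type u) (_ : CommRing F) (_ : Algebra intValued F)
          (L : Module.Basis (PartFun Γ) intValued F), HasMulTable L f) ∧
        -- the graded ring associated to the second is obtained from the first by extension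
        -- of scalars
        ∀ (F : Type v) [CommRing F] [Algebra intValued F]
          (LF : Module.Basis (PartFun Γ) intValued F), HasMulTable LF f →
          ∃ _ : IsRingFiltration (degFil intValued LF) (filLT (degFil intValued LF)),
            ∀ (G : Type w) [CommRing G] (LG : Module.Basis (PartFun Γ) ℤ G), HasMulTable LG a →
              ∃ e : AssocGr (degFil intValued LF) ≃ₐ[intValued] intValued ⊗[ℤ] G,
                (∀ μ, e (grClass intValued LF μ) = 1 ⊗ₜ[ℤ] LG μ) ∧
                -- `e` respects the gradings
                ∀ d : ℕ, (LinearMap.range (DirectSum.lof intValued ℕ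
                    (GrPiece (degFil intValued LF)) d)).map e.toLinearMap =
                  Submodule.span intValued {t | ∃ μ, μ.degree = d ∧ t = 1 ⊗ₜ[ℤ] LG μ} := by
  have hK := isRingFiltration_K (Γ := Γ)
  refine ⟨hK, topTable, topTable_ne_zero, fun n => ⟨exists_grBasis_K Γ n, K_eq_zero n,
    hasMulTable_grClass_K Γ n⟩, polyTable, polyTable_unique, fun l m ν h => ?_,
    polyTable_eq_topTable, exists_topTable_ring Γ, exists_polyTable_ring Γ, ?_⟩
  · by_contra h'
    exact h.not_ge (polyTable_ne_zero l m ν h')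
  · intro F _ _ LF hF
    have hfil := isRingFiltration_degFil hF (polyTable_basis_zero hF) polyTable_ne_zero
    refine ⟨hfil, fun G _ LG hG => ?_⟩
    obtain ⟨e, he⟩ := exists_algEquiv_baseChange LF hF LG hG
    refine ⟨e, he, fun d => ?_⟩
    -- Each graded component is spanned by the classes of that degree, whose images under `e` are
    -- known.
    rw [range_lof_degFil, Submodule.map_span]
    congr 1
    ext t
    constructor
    · rintro ⟨_, ⟨μ, hμ, rfl⟩, rfl⟩
      exact ⟨μ, hμ, he μ⟩
    · rintro ⟨μ, hμ, rfl⟩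
      exact ⟨_, ⟨μ, hμ, rfl⟩, he μ⟩
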